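/- A partition is identified with its Young diagram; $|\alpha|$ is its size, $\ell(\alpha)$ the number of its positive parts, and $\alpha_i=0$ for $i>\ell(\alpha)$. A ribbon (connected or not) is a skew shape that contains no $2\times2$ block. Let $\alpha$ be a partition all of whose parts are $\ge 2$, and let $R=R_\alpha^p$ be a ribbon whose row lengths, from top to bottom, are $\alpha_1\ge\alpha_2\ge\cdots\ge\alpha_{\ell(\alpha)}$. Let $p=(p_1,\dots,p_{\ell(\alpha)-1},0)$ be its overlapping partition, where $p_i$ is the number of columns of length two in the last $\ell(\alpha)-i+1$ rows of $R$; $\ell(p)$ is the number of positive $p_i$. The Schur support $[R]$ is the set of partitions $\nu$ with $c_R^\nu>0$, where $s_R=\sum_\nu c_R^\nu s_\nu$ is the expansion of the skew Schur function of $R$ in Schur functions, and $[\alpha,(|\alpha|-p_1,p_1)]$ denotes the interval in the dominance order on partitions of $|\alpha|$. Put $[x]_+=\max\{0,x\}$ and, for $1\le i\le\ell(p)-1$, $$\varrho_i = 1+\sum_{q=i+1}^{\ell(\alpha)}\alpha_q-p_{i+1}.$$ **Theorem.** One has $[R_\alpha^p]=[\alpha,(|\alpha|-p_1,p_1)]$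 if and only if either $\ell(p)<2$, or $\ell(p)\ge2$ and for every $1\le i\le\ell(p)-1$ the $i$-witness vector $([\varrho_i-\alpha_j]_+)_{1\le j\le i}$ is oversized, that is, $$\sum_{j=1}^{i}[\varrho_i-\alpha_j]_+\ \ge\ p_{i+1}.$$ -/

import Mathlib

/-- A skew shape `outer / inner`, for two partitions (Young diagrams) `inner ⊆ outer`. -/
structure SkewShape where
  outer : YoungDiagram
  inner : YoungDiagram
  inner_le_outer : inner ≤ outer

namespace SkewShape

/-- The boxes `(row, column)` of a skew shape, both coordinates counted from `0`, rows from top to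
bottom and columns from left to right. -/
def cells (A : SkewShape) : Finset (ℕ × ℕ) := A.outer.cells \ A.inner.cells

/-- The number of boxes in row `i`. -/
def rowLen (A : SkewShape) (i : ℕ) : ℕ := (A.cells.filter fun c => c.1 = i).card

/-- The straight shape of a partition, as a skew shape. -/
def straight (ν : YoungDiagram) : SkewShape := ⟨ν, ⊥, bot_le⟩

/-- A ribbon, connected or not: a skew shape without a `2 × 2` block. -/
def IsRibbon (A : SkewShape) : Prop :=
  ¬ ∃ i j : ℕ, (i, j) ∈ A.cells ∧ (i, j + 1) ∈ A.cells ∧ (i + 1, j) ∈ A.cells ∧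
    (i + 1, j + 1) ∈ A.cells

/-- The number of columns of length two in the part of the shape formed by the rows with (0-based)
index at least `i`. In 1-based notation this is `p_{i+1}`. -/
def overlap (A : SkewShape) (i : ℕ) : ℕ :=
  ((A.cells.image Prod.snd).filter fun j =>
    (A.cells.filter fun c => i ≤ c.1 ∧ c.2 = j).card = 2).card

/-- Semistandard fillings of a skew shape, by letters `0, 1, 2, …`: weakly increasing along rows
(left to right), strictly increasing down columns. -/
def IsSemistandard (A : SkewShape) (T : A.cells → ℕ) : Prop :=
  (∀ x y : A.cells, x.1.1 = y.1.1 → x.1.2 ≤ y.1.2 → T x ≤ T y) ∧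
  (∀ x y : A.cells, x.1.2 = y.1.2 → x.1.1 < y.1.1 → T x < T y)

/-- The content of a filling: the multiplicity of each letter. -/
noncomputable def content (A : SkewShape) (T : A.cells → ℕ) : ℕ →₀ ℕ :=
  ∑ x : A.cells, Finsupp.single (T x) 1

/-- The skew Schur function `∑_T x^T`, the sum over all semistandard tableaux `T` of the given
shape, as a power series in the variables `x₀, x₁, …`: the coefficient of a monomial is the number
of semistandard tableaux with that content. -/
noncomputable def schurFunction (A : SkewShape) : MvPowerSeries ℕ ℚ := fun m =>
  (Set.ncard {T : A.cells → ℕ | A.IsSemistandard T ∧ A.content T = m} : ℚ)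

/-- `c` is the family of coefficients in `s_A = ∑_ν c_ν s_ν`, with `ν` running over partitions.
Since Schur functions are linearly independent, a skew shape has only one such family: the
Littlewood–Richardson coefficients of `A`. -/
def IsSchurExpansion (A : SkewShape) (c : YoungDiagram →₀ ℚ) : Prop :=
  A.schurFunction = c.sum fun ν a => a • (straight ν).schurFunction

/-- The Schur support: the set of all partitions `ν` with positive coefficient in the Schur
expansion of `s_A`. -/
def schurSupport (A : SkewShape) : Set YoungDiagram :=
  {ν | ∃ c : YoungDiagram →₀ ℚ, A.IsSchurExpansion c ∧ 0 < c ν}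

end SkewShape

/-! Partitions are also written as sequences `f 0 ≥ f 1 ≥ f 2 ≥ ⋯`, extended by zeros. -/

/-- The length of a partition: the number of its positive parts. -/
noncomputable def partLength (f : ℕ → ℕ) : ℕ := Set.ncard {i | f i ≠ 0}

/-- The size of a partition: the sum of its positive parts. -/
noncomputable def partSize (f : ℕ → ℕ) : ℕ := ∑ i ∈ Finset.range (partLength f), f i

/-- Dominance order on partitions of the same size. -/
def Dominated (f g : ℕ → ℕ) : Prop :=
  partSize f = partSize g ∧ ∀ k, ∑ i ∈ Finset.range k, f i ≤ ∑ i ∈ Finset.range k, g i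

/-- The interval `[f, g]` in the dominance order: all partitions `ν` with `f ⪯ ν ⪯ g`. -/
def dominanceInterval (f g : ℕ → ℕ) : Set YoungDiagram :=
  {ν | Dominated f ν.rowLen ∧ Dominated ν.rowLen g}

/-- The partition `(a, b)` with at most two parts. -/
def twoRows (a b : ℕ) : ℕ → ℕ
  | 0 => a
  | 1 => b
  | _ => 0

/-- `ϱ_i = 1 + ∑_{q = i+1}^{ℓ(α)} α_q - p_{i+1}`, where the 1-based `α_q` and `p_{i+1}` are
`α (q - 1)` and `p i`. -/
noncomputable def rest (α p : ℕ → ℕ) (i : ℕ) : ℤ :=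
  1 + (∑ q ∈ Finset.Ico i (partLength α), (α q : ℤ)) - (p i : ℤ)

/-- The size `∑_{j=1}^{i} [ϱ_i - α_j]_+` of the `i`-witness vector. -/
noncomputable def witnessSize (α p : ℕ → ℕ) (i : ℕ) : ℤ :=
  ∑ j ∈ Finset.range i, max 0 (rest α p i - (α j : ℤ))

/-! Count rows from 0, let S_i = α_i + α_{i+1} + ⋯, and let p_i count the overlaps among the rows
from i on. The theorem rests on a description of the support: ν lies in [R] if and only if ν
dominates α and ν_i + p_i ≤ S_i for every i (`mem_schurSupport_iff_isAdmissible`). The interval only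
asks for dominance and the bound at i = 0 (`mem_dominanceInterval_iff`), so equality says that these
two force all the other bounds.

Suppose the bound fails at i ≥ 1, so ν_i ≥ c with c = S_i + 1 - p_i = ϱ_i. The rows above i are then
at least c too, and dominance gives them at least ∑_{j<i} α_j + ∑_{j<i} [c - α_j]_+ boxes
(`prefixSum_add_deficit_le`). If the witness vector is oversized, these boxes and row i together
exceed |α| (`cap_of_le`). If it is not, raising the rows above i to at least c, giving row i length
c and putting the remainder into row i + 1 yields a partition of the interval outside the support
(`exists_dominating_of_lt`).

For the description of the support, fillings of R are read as words. Row insertion encodes a word by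
a Gelfand–Tsetlin pattern and a lattice word of the same shape, and exchanges rises and falls
(`hasRise_iff_recordingWord`). Hence the coefficient of s_ν counts the lattice words of content ν,
cut into blocks of lengths α_i, without falls inside blocks and with a fall wherever two rows
overlap (`exists_schurExpansion`). Linear independence of Schur functions shows that there is no
other expansion.

In such a word each block adds a horizontal strip. Peeling off the block of row 0 proves by
induction that the bounds are necessary (`bounds_of_latticeWord`). For sufficiency, a strip of size
α_0 is removed from ν so that the rest is as dominant as its own bounds allow (`exists_strip`). The
strip takes a box from the lowest row of maximal length, which keeps the first letter of the word
small; if rows 0 and 1 overlap, it also reaches below row 0, and together these produce the required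
fall (`exists_latticeWord`). -/

/-! ### Gelfand–Tsetlin patterns and row insertion -/

/-- `g k i` is the number of entries `< k` in row `i` of a semistandard tableau with letters `< K`. -/
structure IsGT (K : ℕ) (g : ℕ → ℕ → ℕ) : Prop where
  zero : ∀ i, g 0 i = 0
  mono : ∀ k i, g k i ≤ g (k + 1) i
  interlace : ∀ k i, g (k + 1) (i + 1) ≤ g k i
  stable : ∀ k, K ≤ k → ∀ i, g k i = g K i

namespace IsGT

variable {K : ℕ} {g : ℕ → ℕ → ℕ}

theorem eq_zero (hg : IsGT K g) : ∀ k i, k ≤ i → g k i = 0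
  | 0, i, _ => hg.zero i
  | k + 1, 0, h => by omega
  | k + 1, i + 1, h => by
    have := hg.interlace k i
    have := hg.eq_zero k i (by omega)
    omega

theorem antitone_row (hg : IsGT K g) (k i : ℕ) : g k (i + 1) ≤ g k i :=
  (hg.mono k (i + 1)).trans (hg.interlace k i)

end IsGT

/-- The row of the box added on level `k > x` when `x` is inserted into `g`. -/
def insertionRow (g : ℕ → ℕ → ℕ) (x : ℕ) : ℕ → ℕ
  | 0 => 0
  | k + 1 =>
    if k ≤ x then 0
    else insertionRow g x k +
      if g k (insertionRow g x k) < g (k + 1) (insertionRow g x k) then 1 else 0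

/-- Row insertion of the letter `x`. -/
def rowInsert (g : ℕ → ℕ → ℕ) (x k i : ℕ) : ℕ :=
  g k i + if x < k ∧ i = insertionRow g x k then 1 else 0

theorem insertionRow_of_le (g : ℕ → ℕ → ℕ) {x k : ℕ} (h : k ≤ x + 1) :
    insertionRow g x k = 0 := by
  cases k with
  | zero => rfl
  | succ k => simp [insertionRow, show k ≤ x by omega]

/-- Row r contains g (k + 1) r - g k r letters k. If there is one, the box gained by the letters
below k displaces it into the next row; otherwise the new box stays in row r. -/
theorem insertionRow_succ (g : ℕ → ℕ → ℕ) {x k : ℕ} (h : x < k) :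
    insertionRow g x (k + 1) = insertionRow g x k +
      if g k (insertionRow g x k) < g (k + 1) (insertionRow g x k) then 1 else 0 := by
  simp [insertionRow, show ¬ k ≤ x by omega]

theorem insertionRow_lt (g : ℕ → ℕ → ℕ) {x k : ℕ} (h : x < k) : insertionRow g x k < k := by
  induction k with
  | zero => omega
  | succ k ih =>
    rcases Nat.lt_or_ge x k with hk | hk
    · rw [insertionRow_succ g hk]
      have := ih hk
      split_ifs <;> omega
    · rw [insertionRow_of_le g (by omega)]
      omega

theorem insertionRow_congr {g h : ℕ → ℕ → ℕ} (x : ℕ) {K : ℕ}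
    (hgh : ∀ k ≤ K, ∀ i, g k i = h k i) : ∀ k ≤ K, insertionRow g x k = insertionRow h x k := by
  intro k
  induction k with
  | zero => intro _; rfl
  | succ k ih =>
    intro hk
    rcases Nat.lt_or_ge x k with hx | hx
    · rw [insertionRow_succ g hx, insertionRow_succ h hx, ih (by omega), hgh k (by omega),
        hgh (k + 1) hk]
    · rw [insertionRow_of_le g (by omega), insertionRow_of_le h (by omega)]

theorem insertionRow_stable {K : ℕ} {g : ℕ → ℕ → ℕ} (hg : IsGT K g) {x : ℕ} (hx : x < K) :
    ∀ k, K ≤ k → insertionRow g x k = insertionRow g x K := by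
  intro k hk
  induction k, hk using Nat.le_induction with
  | base => rfl
  | succ k hk ih =>
    rw [insertionRow_succ g (by omega), hg.stable k hk, hg.stable (k + 1) (by omega)]
    simpa using ih

theorem rowInsert_of_le (g : ℕ → ℕ → ℕ) {x k : ℕ} (h : k ≤ x) (i : ℕ) :
    rowInsert g x k i = g k i := by
  simp [rowInsert, show ¬ x < k by omega]

theorem rowInsert_of_lt (g : ℕ → ℕ → ℕ) {x k : ℕ} (h : x < k) (i : ℕ) :
    rowInsert g x k i = g k i + if i = insertionRow g x k then 1 else 0 := by
  simp [rowInsert, h]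

theorem rowInsert_mono {K : ℕ} {g : ℕ → ℕ → ℕ} (hg : IsGT K g) (x k i : ℕ) :
    rowInsert g x k i ≤ rowInsert g x (k + 1) i := by
  have h1 := hg.mono k i
  rcases Nat.lt_or_ge x k with hx | hx
  · rw [rowInsert_of_lt g hx, rowInsert_of_lt g (by omega), insertionRow_succ g hx]
    by_cases hi : i = insertionRow g x k
    · subst hi
      split_ifs <;> omega
    · simp only [hi, if_false]
      omega
  · rw [rowInsert_of_le g hx]
    unfold rowInsert
    omega

/-- After a bump both sides grow in the critical row. Without one, the rows in question agree on the
two levels, and the inequality is inherited from the level below; hence the induction. -/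
theorem rowInsert_interlace {K : ℕ} {g : ℕ → ℕ → ℕ} (hg : IsGT K g) (x k : ℕ) :
    ∀ i, rowInsert g x (k + 1) (i + 1) ≤ rowInsert g x k i := by
  induction k with
  | zero =>
    intro i
    have h1 := hg.interlace 0 i
    unfold rowInsert
    rw [insertionRow_of_le g (show 0 + 1 ≤ x + 1 by omega)]
    simp
    omega
  | succ k ih =>
    intro i
    have h1 := hg.interlace (k + 1) i
    rcases Nat.lt_or_ge x (k + 1) with hx | hx
    · have h2 := ih i
      have h3 := rowInsert_mono hg x k i
      have h4 := hg.mono (k + 1) (i + 1)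
      rw [rowInsert_of_lt g hx] at h2 h3 ⊢
      rw [rowInsert_of_lt g (show x < k + 1 + 1 by omega), insertionRow_succ g hx]
      generalize insertionRow g x (k + 1) = r at *
      by_cases hb : g (k + 1) r < g (k + 1 + 1) r
      · simp only [hb, if_true]
        split_ifs <;> omega
      · simp only [hb, if_false]
        by_cases hr : i + 1 = r
        · subst hr
          simp at h2 h3 ⊢
          omega
        · simp [hr]
          omega
    · rw [rowInsert_of_le g hx]
      unfold rowInsert
      rw [insertionRow_of_le g (show k + 1 + 1 ≤ x + 1 by omega)]
      simp
      omega

theorem IsGT.rowInsert {K : ℕ} {g : ℕ → ℕ → ℕ} (hg : IsGT K g) {x : ℕ} (hx : x < K) :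
    IsGT K (rowInsert g x) where
  zero i := by rw [rowInsert_of_le g (Nat.zero_le x), hg.zero]
  mono := rowInsert_mono hg x
  interlace := rowInsert_interlace hg x
  stable k hk i := by
    rw [rowInsert_of_lt g (by omega), rowInsert_of_lt g hx, insertionRow_stable hg hx k hk,
      hg.stable k hk]

theorem sum_rowInsert (g : ℕ → ℕ → ℕ) (x k : ℕ) :
    ∑ i ∈ Finset.range k, rowInsert g x k i =
      ∑ i ∈ Finset.range k, g k i + if x < k then 1 else 0 := by
  by_cases h : x < k
  · simp [rowInsert_of_lt g h, Finset.sum_add_distrib, insertionRow_lt g h, h]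
  · simp [rowInsert_of_le g (not_lt.mp h), h]

/-- A later smaller letter ends strictly below, a later weakly larger one weakly above. -/
theorem insertionRow_le_of_le {K : ℕ} {g : ℕ → ℕ → ℕ} (hg : IsGT K g) {x y : ℕ} (hxy : x ≤ y) :
    ∀ k, y < k → insertionRow (rowInsert g x) y k ≤ insertionRow g x k := by
  intro k hk
  induction k, hk using Nat.le_induction with
  | base => rw [insertionRow_of_le _ (by omega)]; omega
  | succ k hk ih =>
    rw [insertionRow_succ _ (by omega), insertionRow_succ g (show x < k by omega),
      rowInsert_of_lt g (show x < k by omega), rowInsert_of_lt g (show x < k + 1 by omega),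
      insertionRow_succ g (show x < k by omega)]
    generalize insertionRow g x k = r at *
    generalize insertionRow (rowInsert g x) y k = s at *
    have := hg.mono k r
    rcases Nat.lt_or_ge s r with h | h
    · split_ifs <;> omega
    · obtain rfl : s = r := by omega
      by_cases hb : g k s < g (k + 1) s
      · simp only [hb, if_true]
        split_ifs <;> omega
      -- Row s had no letter k and grew equally on both levels, so the second insertion bumps
      -- nothing there either.
      · simp [hb]

theorem lt_insertionRow_of_lt {K : ℕ} {g : ℕ → ℕ → ℕ} (hg : IsGT K g) {x y : ℕ} (hxy : y < x) :
    ∀ k, x < k → insertionRow g x k < insertionRow (rowInsert g x) y k := by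
  intro k hk
  induction k, hk using Nat.le_induction with
  | base =>
    rw [insertionRow_of_le g (by omega), insertionRow_succ _ hxy,
      rowInsert_of_le g le_rfl, rowInsert_of_lt g (show x < x + 1 by omega),
      insertionRow_of_le g (show x + 1 ≤ x + 1 by omega)]
    generalize insertionRow (rowInsert g x) y x = s at *
    have := hg.mono x s
    by_cases hs : s = 0
    · simp only [hs, if_true] at *
      split_ifs <;> omega
    · omega
  | succ k hk ih =>
    rw [insertionRow_succ _ (show y < k by omega), insertionRow_succ g (show x < k by omega),
      rowInsert_of_lt g (show x < k by omega), rowInsert_of_lt g (show x < k + 1 by omega),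
      insertionRow_succ g (show x < k by omega)]
    generalize insertionRow g x k = r at *
    generalize insertionRow (rowInsert g x) y k = s at *
    have := hg.mono k s
    by_cases hb : g k r < g (k + 1) r
    · simp only [hb, if_true]
      -- In this case the letter k bumped by the first insertion has landed in row s, so the second
      -- insertion bumps as well.
      by_cases hs : s = r + 1
      · subst hs
        rw [if_pos]
        · omega
        · simp
          omega
      · omega
    · simp only [hb, if_false]
      omega

/-! ### Reverse insertion -/

/-- Every removable box, in row `r`, of a pattern with `K` levels is the last box of an insertion. -/
theorem exists_rowInsert_eq {g' : ℕ → ℕ → ℕ} (h0 : ∀ i, g' 0 i = 0) :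
    ∀ (K r : ℕ), (∀ k < K, ∀ i, g' k i ≤ g' (k + 1) i) →
      (∀ k < K, ∀ i, g' (k + 1) (i + 1) ≤ g' k i) → g' K (r + 1) < g' K r →
      ∃ g x, x < K ∧ (∀ i, g 0 i = 0) ∧ (∀ k < K, ∀ i, g k i ≤ g (k + 1) i) ∧
        (∀ k < K, ∀ i, g (k + 1) (i + 1) ≤ g k i) ∧
        (∀ k ≤ K, ∀ i, rowInsert g x k i = g' k i) ∧ insertionRow g x K = r := by
  intro K
  induction K with
  | zero =>
    intro r _ _ h
    rw [h0, h0] at h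
    omega
  | succ K ih =>
    intro r hm hi hr
    -- extension of a pattern with `K` levels by the row `g' (K + 1)` without its box in row `r`
    have key : ∀ (g : ℕ → ℕ → ℕ) (x : ℕ), x ≤ K → (∀ i, g 0 i = 0) →
        (∀ k < K, ∀ i, g k i ≤ g (k + 1) i) → (∀ k < K, ∀ i, g (k + 1) (i + 1) ≤ g k i) →
        (∀ k ≤ K, ∀ i, rowInsert g x k i = g' k i) →
        (∀ i, g K i ≤ g' (K + 1) i - if i = r then 1 else 0) →
        (∀ i, g' (K + 1) (i + 1) - (if i + 1 = r then 1 else 0) ≤ g K i) →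
        (∀ f : ℕ → ℕ → ℕ, (∀ k ≤ K, ∀ i, f k i = g k i) →
          (∀ i, f (K + 1) i = g' (K + 1) i - if i = r then 1 else 0) →
          insertionRow f x (K + 1) = r) →
        ∃ g x, x < K + 1 ∧ (∀ i, g 0 i = 0) ∧ (∀ k < K + 1, ∀ i, g k i ≤ g (k + 1) i) ∧
          (∀ k < K + 1, ∀ i, g (k + 1) (i + 1) ≤ g k i) ∧
          (∀ k ≤ K + 1, ∀ i, rowInsert g x k i = g' k i) ∧ insertionRow g x (K + 1) = r := by
      intro g x hx hz hgm hgi hgr h1 h2 h3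
      let f : ℕ → ℕ → ℕ := fun k i =>
        if k ≤ K then g k i else g' (K + 1) i - if i = r then 1 else 0
      have f1 : ∀ k ≤ K, ∀ i, f k i = g k i := fun k hk i => by simp [f, hk]
      have f2 : ∀ i, f (K + 1) i = g' (K + 1) i - if i = r then 1 else 0 := fun i => by simp [f]
      have f3 := h3 f f1 f2
      refine ⟨f, x, by omega, fun i => by rw [f1 0 (by omega), hz], ?_, ?_, ?_, f3⟩
      · intro k hk i
        rcases Nat.lt_or_ge k K with h | h
        · rw [f1 k h.le, f1 (k + 1) h]; exact hgm k h i
        · obtain rfl : k = K := by omega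
          rw [f1 k le_rfl, f2]; exact h1 i
      · intro k hk i
        rcases Nat.lt_or_ge k K with h | h
        · rw [f1 k h.le, f1 (k + 1) h]; exact hgi k h i
        · obtain rfl : k = K := by omega
          rw [f1 k le_rfl, f2]; exact h2 i
      · intro k hk i
        rcases Nat.lt_or_ge k (K + 1) with h | h
        · rw [← hgr k (by omega)]
          unfold rowInsert
          rw [insertionRow_congr x f1 k (by omega), f1 k (by omega)]
        · obtain rfl : k = K + 1 := by omega
          rw [rowInsert_of_lt f (by omega), f3, f2]
          by_cases hir : i = r
          · subst hir
            simp
            omega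
          · simp [hir]
    have hmK := hm K (by omega)
    have hiK := hi K (by omega)
    -- If row r has no letter K, its last box is already removable on level K. Otherwise that box
    -- holds a K, which was the inserted letter itself (r = 0) or was bumped out of row r - 1.
    rcases (hmK r).eq_or_lt with he | hlt
    · obtain ⟨g, x, hx, hz, hgm, hgi, hgr, hrow⟩ := ih r (fun k hk => hm k (by omega))
        (fun k hk => hi k (by omega)) (by have := hmK (r + 1); omega)
      have hK : ∀ i, g K i + (if i = r then 1 else 0) = g' K i := fun i => by
        rw [← hgr K le_rfl, rowInsert_of_lt g hx, hrow]
      refine key g x hx.le hz hgm hgi hgr ?_ ?_ ?_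
      · intro i
        have := hK i
        have := hmK i
        split_ifs at * <;> omega
      · intro i
        have h1 := hK i
        have h2 := hiK i
        have h3 := hK (i + 1)
        by_cases hir : i = r
        · subst hir
          have := hmK (i + 1)
          simp at *
          omega
        · simp [hir] at *
          omega
      · intro f f1 f2
        rw [insertionRow_succ f hx, insertionRow_congr x f1 K le_rfl, hrow, f1 K le_rfl, f2]
        have := hK r
        simp at this ⊢
        omega
    · cases r with
      | zero =>
        have hrow : ∀ f : ℕ → ℕ → ℕ, insertionRow f K (K + 1) = 0 := fun f =>
          insertionRow_of_le f le_rfl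
        refine key g' K le_rfl h0 (fun k hk => hm k (by omega)) (fun k hk => hi k (by omega))
          (fun k hk i => rowInsert_of_le g' hk i) ?_ ?_ (fun f _ _ => hrow f)
        · intro i
          have := hmK i
          by_cases hi0 : i = 0
          · subst hi0; simp; omega
          · simp [hi0, this]
        · intro i
          simpa using hiK i
      | succ t =>
        obtain ⟨g, x, hx, hz, hgm, hgi, hgr, hrow⟩ := ih t (fun k hk => hm k (by omega))
          (fun k hk => hi k (by omega)) (by have := hiK t; omega)
        have hK : ∀ i, g K i + (if i = t then 1 else 0) = g' K i := fun i => by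
          rw [← hgr K le_rfl, rowInsert_of_lt g hx, hrow]
        refine key g x hx.le hz hgm hgi hgr ?_ ?_ ?_
        · intro i
          have := hK i
          have := hmK i
          by_cases h : i = t + 1
          · subst h; simp at *; omega
          · simp [h]; split_ifs at * <;> omega
        · intro i
          have := hK i
          have := hiK i
          by_cases h : i = t
          · subst h; simp at *; omega
          · simp [h] at *; omega
        · intro f f1 f2
          rw [insertionRow_succ f hx, insertionRow_congr x f1 K le_rfl, hrow, f1 K le_rfl, f2]
          have := hK t
          have := hmK t
          simp at *
          omega

/-- Reverse bumping is deterministic: the result has a letter K in the final row exactly when the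
last step was a bump or the insertion of K itself. So the top two levels determine the path one
level lower. -/
theorem rowInsert_injective {g h : ℕ → ℕ → ℕ} {x y : ℕ} :
    ∀ K, (∀ k < K, ∀ i, g k i ≤ g (k + 1) i) → (∀ k < K, ∀ i, h k i ≤ h (k + 1) i) →
      x < K → y < K → (∀ k ≤ K, ∀ i, rowInsert g x k i = rowInsert h y k i) →
      insertionRow g x K = insertionRow h y K →
      x = y ∧ ∀ k ≤ K, x < k → insertionRow g x k = insertionRow h y k := by
  intro K
  induction K with
  | zero => intro _ _ hx; omega
  | succ K ih =>
    intro hg hh hx hy he hr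
    have e1 := he K (by omega)
    have e2 := he (K + 1) le_rfl
    have hgK := hg K (by omega)
    have hhK := hh K (by omega)
    rcases Nat.lt_or_ge x K with hxK | hxK <;> rcases Nat.lt_or_ge y K with hyK | hyK
    · have hrK : insertionRow g x K = insertionRow h y K := by
        have b1 := insertionRow_succ g hxK
        have b2 := insertionRow_succ h hyK
        have c1 := e1 (insertionRow g x (K + 1))
        have c2 := e2 (insertionRow g x (K + 1))
        have c3 := hgK (insertionRow g x (K + 1))
        have c4 := hhK (insertionRow g x (K + 1))
        rw [rowInsert_of_lt g (by omega), rowInsert_of_lt h (by omega)] at c1 c2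
        rw [← hr] at b2 c2
        generalize insertionRow g x (K + 1) = s at *
        generalize insertionRow g x K = a at *
        generalize insertionRow h y K = b at *
        by_cases ha : g K a < g (K + 1) a <;> by_cases hb : h K b < h (K + 1) b
        · simp only [ha, hb, if_true] at b1 b2; omega
        · simp only [ha, hb, if_true, if_false] at b1 b2
          subst b2
          subst b1
          simp at *
          omega
        · simp only [ha, hb, if_true, if_false] at b1 b2
          subst b1
          subst b2
          simp at *
          omega
        · simp only [ha, hb, if_false] at b1 b2; omega
      obtain ⟨h1, h2⟩ := ih (fun k hk => hg k (by omega)) (fun k hk => hh k (by omega)) hxK hyK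
        (fun k hk => he k (by omega)) hrK
      refine ⟨h1, fun k hk hxk => ?_⟩
      rcases Nat.lt_or_ge k (K + 1) with h | h
      · exact h2 k (by omega) hxk
      · obtain rfl : k = K + 1 := by omega
        exact hr
    · exfalso
      obtain rfl : y = K := by omega
      rw [insertionRow_of_le h le_rfl, insertionRow_succ g hxK] at hr
      have c1 := e1 0
      have c2 := e2 0
      have := hhK 0
      rw [rowInsert_of_lt g (by omega), rowInsert_of_le h le_rfl] at c1
      rw [rowInsert_of_lt g (by omega), rowInsert_of_lt h (by omega),
        insertionRow_of_le h le_rfl, insertionRow_succ g hxK, hr] at c2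
      obtain ⟨hr1, hr2⟩ := Nat.add_eq_zero_iff.mp hr
      rw [hr1] at c1 hr2
      simp at *
      omega
    · exfalso
      obtain rfl : x = K := by omega
      rw [insertionRow_of_le g le_rfl, insertionRow_succ h hyK] at hr
      have c1 := e1 0
      have c2 := e2 0
      have := hgK 0
      rw [rowInsert_of_lt h (by omega), rowInsert_of_le g le_rfl] at c1
      rw [rowInsert_of_lt h (by omega), rowInsert_of_lt g (by omega),
        insertionRow_of_le g le_rfl, insertionRow_succ h hyK, ← hr] at c2
      obtain ⟨hr1, hr2⟩ := Nat.add_eq_zero_iff.mp hr.symm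
      rw [hr1] at c1 hr2
      simp at *
      omega
    · obtain rfl : x = K := by omega
      obtain rfl : y = x := by omega
      refine ⟨rfl, fun k hk hxk => ?_⟩
      obtain rfl : k = y + 1 := by omega
      exact hr

/-! ### The Robinson–Schensted–Knuth correspondence for words

Words and lattice words are lists whose head is the latest letter. -/

/-- The insertion tableau of a word. -/
def insertionPattern : List ℕ → ℕ → ℕ → ℕ
  | [] => fun _ _ => 0
  | x :: w => rowInsert (insertionPattern w) x

/-- The recording word: the rows of the boxes added by the successive insertions. -/
def recordingWord (K : ℕ) : List ℕ → List ℕ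
  | [] => []
  | x :: w => insertionRow (insertionPattern w) x K :: recordingWord K w

/-- Every suffix contains at least as many letters `r` as `r + 1`. -/
def IsLattice : List ℕ → Prop
  | [] => True
  | r :: q => IsLattice q ∧ ∀ i, (r :: q).count (i + 1) ≤ (r :: q).count i

theorem IsLattice.count_succ_le {q : List ℕ} (hq : IsLattice q) (i : ℕ) :
    q.count (i + 1) ≤ q.count i := by
  cases q with
  | nil => simp
  | cons r q => exact hq.2 i

theorem IsLattice.of_append {s q : List ℕ} (h : IsLattice (s ++ q)) : IsLattice q := by
  induction s with
  | nil => exact h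
  | cons r s ih => exact ih h.1

theorem isGT_insertionPattern {K : ℕ} : ∀ {w : List ℕ}, (∀ x ∈ w, x < K) →
    IsGT K (insertionPattern w)
  | [], _ => ⟨fun _ => rfl, fun _ _ => le_rfl, fun _ _ => le_rfl, fun _ _ _ => rfl⟩
  | x :: w, h => by
    have h' := List.forall_mem_cons.mp h
    exact (isGT_insertionPattern h'.2).rowInsert h'.1

theorem length_recordingWord (K : ℕ) : ∀ w : List ℕ, (recordingWord K w).length = w.length
  | [] => rfl
  | x :: w => by simp [recordingWord, length_recordingWord K w]

theorem count_recordingWord {K : ℕ} : ∀ {w : List ℕ}, (∀ x ∈ w, x < K) → ∀ i,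
    insertionPattern w K i = (recordingWord K w).count i
  | [], _, i => by simp [insertionPattern, recordingWord]
  | x :: w, h, i => by
    have h' := List.forall_mem_cons.mp h
    rw [insertionPattern, recordingWord, rowInsert_of_lt _ h'.1, count_recordingWord h'.2,
      List.count_cons]
    simp only [beq_iff_eq, eq_comm (a := i)]

theorem isLattice_recordingWord {K : ℕ} : ∀ {w : List ℕ}, (∀ x ∈ w, x < K) →
    IsLattice (recordingWord K w)
  | [], _ => trivial
  | x :: w, h => by
    have h' := List.forall_mem_cons.mp h
    refine ⟨isLattice_recordingWord h'.2, fun i => ?_⟩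
    have := (isGT_insertionPattern h).antitone_row K i
    rwa [count_recordingWord h, count_recordingWord h] at this

theorem sum_insertionPattern (w : List ℕ) (k : ℕ) :
    ∑ i ∈ Finset.range k, insertionPattern w k i = w.countP (· < k) := by
  induction w with
  | nil => simp [insertionPattern]
  | cons x w ih =>
    rw [insertionPattern, sum_rowInsert, ih, List.countP_cons]
    simp

/-- The entry in position `t` is smaller than the next one. -/
def HasRise (w : List ℕ) (t : ℕ) : Prop := w.getD t 0 < w.getD (t + 1) 0

/-- Insertion exchanges rises of words and falls of recording words. -/
theorem hasRise_iff_recordingWord {K : ℕ} : ∀ {w : List ℕ}, (∀ x ∈ w, x < K) → ∀ t,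
    t + 1 < w.length →
    (HasRise w t ↔ (recordingWord K w).getD (t + 1) 0 < (recordingWord K w).getD t 0)
  | [], _, t, ht => by simp at ht
  | [x], _, t, ht => by simp at ht
  | y :: x :: w, h, 0, _ => by
    have h1 := List.forall_mem_cons.mp h
    have h2 := List.forall_mem_cons.mp h1.2
    have hg := isGT_insertionPattern h2.2
    simp only [HasRise, recordingWord, insertionPattern, List.getD_cons_zero, zero_add,
      List.getD_cons_succ]
    constructor
    · intro hxy
      exact lt_insertionRow_of_lt hg hxy K h2.1
    · intro hr
      by_contra hxy
      exact absurd (insertionRow_le_of_le hg (not_lt.mp hxy) K h1.1) (not_le.mpr hr)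
  | y :: x :: w, h, t + 1, ht => by
    have h1 := List.forall_mem_cons.mp h
    have := hasRise_iff_recordingWord h1.2 t (by simpa using ht)
    unfold HasRise at this ⊢
    rw [recordingWord]
    simpa only [List.getD_cons_succ] using this

/-- The lattice condition makes the box named by the head of q removable, so reverse insertion can
be repeated along q. -/
theorem exists_word {K : ℕ} : ∀ {q : List ℕ}, IsLattice q → ∀ {g : ℕ → ℕ → ℕ}, IsGT K g →
    (∀ i, g K i = q.count i) →
    ∃ w : List ℕ, (∀ x ∈ w, x < K) ∧ recordingWord K w = q ∧ insertionPattern w = g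
  | [], _, g, hg, hs => by
    refine ⟨[], by simp, rfl, ?_⟩
    funext k i
    have hK : ∀ i, g K i = 0 := by simpa using hs
    have hle : ∀ j, g k i ≤ g (k + j) i := fun j => by
      induction j with
      | zero => exact le_rfl
      | succ j ih => exact ih.trans (hg.mono _ _)
    have := hle K
    rw [hg.stable (k + K) (by omega), hK] at this
    simp [insertionPattern]
    omega
  | r :: q, hq, g', hg', hs => by
    have hrem : g' K (r + 1) < g' K r := by
      rw [hs, hs, List.count_cons, List.count_cons]
      have := hq.1.count_succ_le r
      simp
      omega
    obtain ⟨g, x, hx, hz, hgm, hgi, hgr, hrow⟩ := exists_rowInsert_eq hg'.zero K r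
      (fun k _ => hg'.mono k) (fun k _ => hg'.interlace k) hrem
    have hfK : ∀ i, g K i = q.count i := fun i => by
      have := hgr K le_rfl i
      rw [rowInsert_of_lt g hx, hrow, hs, List.count_cons] at this
      simp only [beq_iff_eq, eq_comm (a := i)] at this
      split_ifs at this <;> omega
    -- Reverse insertion controls only the levels up to K; freezing the pattern from there on
    -- restores stability.
    let f : ℕ → ℕ → ℕ := fun k i => g (min k K) i
    have f1 : ∀ k ≤ K, ∀ i, f k i = g k i := fun k hk i => by simp [f, hk]
    have hf : IsGT K f := by
      refine ⟨fun i => by simp [f, hz], fun k i => ?_, fun k i => ?_, fun k hk i => by simp [f, hk]⟩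
      · rcases Nat.lt_or_ge k K with h | h
        · rw [f1 k h.le, f1 (k + 1) h]; exact hgm k h i
        · simp [f, h, show K ≤ k + 1 by omega]
      · rcases Nat.lt_or_ge k K with h | h
        · rw [f1 k h.le, f1 (k + 1) h]; exact hgi k h i
        · simp only [f, min_eq_right h, min_eq_right (show K ≤ k + 1 by omega), hfK]
          exact hq.1.count_succ_le i
    obtain ⟨w, hw, hwq, hwg⟩ := exists_word hq.1 hf (fun i => by rw [f1 K le_rfl, hfK])
    have hrow' : insertionRow f x K = r := by rw [insertionRow_congr x f1 K le_rfl, hrow]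
    refine ⟨x :: w, List.forall_mem_cons.mpr ⟨hx, hw⟩, ?_, ?_⟩
    · rw [recordingWord, hwg, hwq, hrow']
    · rw [insertionPattern, hwg]
      have hle : ∀ k ≤ K, ∀ i, rowInsert f x k i = g' k i := fun k hk i => by
        rw [← hgr k hk]
        unfold rowInsert
        rw [insertionRow_congr x f1 k hk, f1 k hk]
      funext k i
      rcases le_total k K with h | h
      · exact hle k h i
      · rw [(hf.rowInsert hx).stable k h, hle K le_rfl, hg'.stable k h]

theorem word_unique {K : ℕ} : ∀ {w v : List ℕ}, (∀ x ∈ w, x < K) → (∀ x ∈ v, x < K) →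
    recordingWord K w = recordingWord K v → insertionPattern w = insertionPattern v → w = v
  | [], [], _, _, _, _ => rfl
  | [], y :: v, _, _, h, _ => by simp [recordingWord] at h
  | x :: w, [], _, _, h, _ => by simp [recordingWord] at h
  | x :: w, y :: v, hw, hv, hq, hp => by
    have hw' := List.forall_mem_cons.mp hw
    have hv' := List.forall_mem_cons.mp hv
    have hgw := isGT_insertionPattern hw'.2
    have hgv := isGT_insertionPattern hv'.2
    simp only [recordingWord, List.cons.injEq] at hq
    simp only [insertionPattern] at hp
    obtain ⟨rfl, hrow⟩ := rowInsert_injective K (fun k _ => hgw.mono k) (fun k _ => hgv.mono k)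
      hw'.1 hv'.1 (fun k _ i => by rw [hp]) hq.1
    rw [word_unique hw'.2 hv'.2 hq.2]
    have hle : ∀ k ≤ K, ∀ i, insertionPattern w k i = insertionPattern v k i := fun k hk i => by
      have := congrFun (congrFun hp k) i
      rcases Nat.lt_or_ge x k with h | h
      · rw [rowInsert_of_lt _ h, rowInsert_of_lt _ h, hrow k hk h] at this
        omega
      · rwa [rowInsert_of_le _ h, rowInsert_of_le _ h] at this
    funext k i
    rcases le_total k K with h | h
    · exact hle k h i
    · rw [hgw.stable k h, hgv.stable k h, hle K le_rfl]

/-! ### Semistandard tableaux as Gelfand–Tsetlin patterns -/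

namespace SkewShape

theorem mem_cells_iff (A : SkewShape) (i j : ℕ) :
    (i, j) ∈ A.cells ↔ A.inner.rowLen i ≤ j ∧ j < A.outer.rowLen i := by
  rw [cells, Finset.mem_sdiff, YoungDiagram.mem_cells, YoungDiagram.mem_cells,
    YoungDiagram.mem_iff_lt_rowLen, YoungDiagram.mem_iff_lt_rowLen, not_lt, and_comm]

theorem mem_cells_straight_iff (ν : YoungDiagram) (i j : ℕ) :
    (i, j) ∈ (straight ν).cells ↔ j < ν.rowLen i := by
  simp [straight, cells, YoungDiagram.mem_iff_lt_rowLen]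

theorem content_apply (A : SkewShape) (T : A.cells → ℕ) (k : ℕ) :
    A.content T k = (Finset.univ.filter fun x => T x = k).card := by
  rw [content, Finsupp.finsetSum_apply, Finset.card_filter]
  exact Finset.sum_congr rfl fun x _ => by rw [Finsupp.single_apply]

theorem sum_content (A : SkewShape) (T : A.cells → ℕ) (k : ℕ) :
    ∑ j ∈ Finset.range k, A.content T j = (Finset.univ.filter fun x => T x < k).card := by
  rw [Finset.card_eq_sum_card_fiberwise (f := T) (t := Finset.range k)]
  · refine Finset.sum_congr rfl fun j hj => ?_
    rw [content_apply, Finset.filter_filter]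
    congr 1
    ext x
    have := Finset.mem_range.mp hj
    simp
    omega
  · intro x hx
    simpa using hx

end SkewShape

theorem Finsupp.eq_of_sum_range_eq {m m' : ℕ →₀ ℕ}
    (h : ∀ k, ∑ j ∈ Finset.range k, m j = ∑ j ∈ Finset.range k, m' j) : m = m' := by
  ext k
  have := h (k + 1)
  rw [Finset.sum_range_succ, Finset.sum_range_succ, h k] at this
  omega

theorem Finset.lt_card_filter_range_iff {n : ℕ} {P : ℕ → Prop} [DecidablePred P]
    (hP : ∀ a b, a ≤ b → b < n → P b → P a) (j : ℕ) :
    j < ((Finset.range n).filter P).card ↔ j < n ∧ P j := by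
  constructor
  · intro h
    by_contra hc
    have : (Finset.range n).filter P ⊆ Finset.range j := by
      intro a ha
      rw [Finset.mem_filter, Finset.mem_range] at ha
      rw [Finset.mem_range]
      by_contra haj
      exact hc ⟨by omega, hP j a (by omega) ha.1 ha.2⟩
    have := Finset.card_le_card this
    rw [Finset.card_range] at this
    omega
  · rintro ⟨h1, h2⟩
    have : Finset.range (j + 1) ⊆ (Finset.range n).filter P := by
      intro a ha
      rw [Finset.mem_range] at ha
      rw [Finset.mem_filter, Finset.mem_range]
      exact ⟨by omega, hP a j (by omega) h1 h2⟩
    have := Finset.card_le_card this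
    rw [Finset.card_range] at this
    omega

namespace SkewShape

/-- `g` is the pattern of the tableau `T`. -/
def IsPatternOf (ν : YoungDiagram) (T : (straight ν).cells → ℕ) (g : ℕ → ℕ → ℕ) : Prop :=
  (∀ k i, g k i ≤ ν.rowLen i) ∧ ∀ (x : (straight ν).cells) (k : ℕ), T x < k ↔ x.1.2 < g k x.1.1

variable {ν : YoungDiagram}

/-- Columns increase strictly, so the letters below k all lie in the first k rows. -/
theorem IsPatternOf.sum_eq {T : (straight ν).cells → ℕ} {g : ℕ → ℕ → ℕ} (h : IsPatternOf ν T g)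
    {K : ℕ} (hg : IsGT K g) (k : ℕ) :
    ∑ i ∈ Finset.range k, g k i = ∑ j ∈ Finset.range k, (straight ν).content T j := by
  rw [sum_content, ← Finset.sum_congr rfl fun i _ => Finset.card_range (g k i),
    ← Finset.card_sigma]
  refine Finset.card_bij' (fun c hc => ⟨(c.1, c.2), ?_⟩) (fun x _ => ⟨x.1.1, x.1.2⟩) ?_ ?_ ?_ ?_
  · rw [mem_cells_straight_iff]
    have := Finset.mem_range.mp (Finset.mem_sigma.mp hc).2
    have := h.1 k c.1
    omega
  · intro c hc
    have := Finset.mem_range.mp (Finset.mem_sigma.mp hc).2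
    simp only [Finset.mem_filter, Finset.mem_univ, true_and]
    rw [h.2]
    exact this
  · intro x hx
    simp only [Finset.mem_filter, Finset.mem_univ, true_and] at hx
    rw [h.2] at hx
    simp only [Finset.mem_sigma, Finset.mem_range]
    refine ⟨?_, hx⟩
    by_contra hk
    have := hg.eq_zero k x.1.1 (by omega)
    omega
  · intro c hc
    rfl
  · intro x hx
    rfl

theorem IsPatternOf.eq {T T' : (straight ν).cells → ℕ} {g : ℕ → ℕ → ℕ} (h : IsPatternOf ν T g)
    (h' : IsPatternOf ν T' g) : T = T' := by
  funext x
  have h1 := (h'.2 x (T x + 1)).mpr ((h.2 x (T x + 1)).mp (by omega))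
  have h2 := (h.2 x (T' x + 1)).mpr ((h'.2 x (T' x + 1)).mp (by omega))
  omega

theorem IsPatternOf.pattern_eq {T : (straight ν).cells → ℕ} {g g' : ℕ → ℕ → ℕ}
    (h : IsPatternOf ν T g) (h' : IsPatternOf ν T g') : g = g' := by
  funext k i
  by_contra hne
  rcases Nat.lt_or_gt_of_ne hne with hlt | hlt
  · have hx : (i, g k i) ∈ (straight ν).cells := by
      rw [mem_cells_straight_iff]
      have := h'.1 k i
      omega
    have h1 := h.2 ⟨_, hx⟩ k
    rw [h'.2 ⟨_, hx⟩ k] at h1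
    simp at h1
    omega
  · have hx : (i, g' k i) ∈ (straight ν).cells := by
      rw [mem_cells_straight_iff]
      have := h.1 k i
      omega
    have h1 := h'.2 ⟨_, hx⟩ k
    rw [h.2 ⟨_, hx⟩ k] at h1
    simp at h1
    omega

theorem IsSemistandard.exists_pattern {T : (straight ν).cells → ℕ}
    (hT : (straight ν).IsSemistandard T) {K : ℕ} (hK : ∀ x, T x < K) :
    ∃ g, IsGT K g ∧ (∀ i, g K i = ν.rowLen i) ∧ IsPatternOf ν T g := by
  classical
  let P : ℕ → ℕ → ℕ → Prop := fun k i j =>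
    ∃ h : (i, j) ∈ (straight ν).cells, T ⟨(i, j), h⟩ < k
  let g : ℕ → ℕ → ℕ := fun k i => ((Finset.range (ν.rowLen i)).filter (P k i)).card
  have hg : ∀ k i j, j < g k i ↔ P k i j := by
    intro k i j
    rw [Finset.lt_card_filter_range_iff]
    · constructor
      · exact And.right
      · intro h
        exact ⟨(mem_cells_straight_iff ν i j).mp h.1, h⟩
    · rintro a b hab hb ⟨h1, h2⟩
      have ha : (i, a) ∈ (straight ν).cells := by rw [mem_cells_straight_iff]; omega
      exact ⟨ha, (hT.1 ⟨_, ha⟩ ⟨_, h1⟩ rfl hab).trans_lt h2⟩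
  have hle : ∀ k i k' i', (∀ j, P k i j → P k' i' j) → g k i ≤ g k' i' := by
    intro k i k' i' h
    by_contra hlt
    exact lt_irrefl _ ((hg _ _ _).mpr (h _ ((hg _ _ _).mp (not_le.mp hlt))))
  refine ⟨g, ⟨?_, ?_, ?_, ?_⟩, ?_, ?_, ?_⟩
  · intro i
    simp [g, P]
  · intro k i
    refine hle _ _ _ _ ?_
    rintro j ⟨h1, h2⟩
    exact ⟨h1, by omega⟩
  · intro k i
    refine hle _ _ _ _ ?_
    rintro j ⟨h1, h2⟩
    have h3 : (i, j) ∈ (straight ν).cells := by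
      rw [mem_cells_straight_iff] at h1 ⊢
      exact h1.trans_le (ν.rowLen_anti _ _ (by omega))
    have h4 : T ⟨(i, j), h3⟩ < T ⟨(i + 1, j), h1⟩ := hT.2 ⟨_, h3⟩ ⟨_, h1⟩ rfl (Nat.lt_succ_self i)
    exact ⟨h3, by omega⟩
  · intro k hk i
    refine le_antisymm (hle _ _ _ _ ?_) (hle _ _ _ _ ?_)
    · rintro j ⟨h1, h2⟩
      exact ⟨h1, hK _⟩
    · rintro j ⟨h1, h2⟩
      exact ⟨h1, by omega⟩
  · intro i
    refine le_antisymm ((Finset.card_filter_le _ _).trans (by simp)) ?_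
    by_contra hlt
    have hx : (i, g K i) ∈ (straight ν).cells := by rw [mem_cells_straight_iff]; omega
    exact lt_irrefl _ ((hg K i _).mpr ⟨hx, hK _⟩)
  · intro k i
    exact (Finset.card_filter_le _ _).trans (by simp)
  · intro x k
    rw [hg]
    exact ⟨fun h => ⟨x.2, h⟩, fun h => h.2⟩

theorem _root_.IsGT.le_of_le {K : ℕ} {g : ℕ → ℕ → ℕ} (hg : IsGT K g) {k k' : ℕ} (h : k ≤ k')
    (i : ℕ) : g k i ≤ g k' i := by
  induction k', h using Nat.le_induction with
  | base => exact le_rfl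
  | succ k' _ ih => exact ih.trans (hg.mono k' i)

theorem _root_.IsGT.exists_tableau {K : ℕ} {g : ℕ → ℕ → ℕ} (hg : IsGT K g)
    (hs : ∀ i, g K i = ν.rowLen i) :
    ∃ T : (straight ν).cells → ℕ, (straight ν).IsSemistandard T ∧ IsPatternOf ν T g := by
  let T : (straight ν).cells → ℕ := fun x =>
    ((Finset.range K).filter fun k => g (k + 1) x.1.1 ≤ x.1.2).card
  have hT : ∀ x k, T x < k ↔ x.1.2 < g k x.1.1 := by
    intro x k
    cases k with
    | zero => simp [hg.zero]
    | succ k =>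
      have h1 : k < T x ↔ k < K ∧ g (k + 1) x.1.1 ≤ x.1.2 := by
        refine Finset.lt_card_filter_range_iff ?_ k
        intro a b hab _ hb
        exact (hg.le_of_le (by omega) _).trans hb
      have h2 : K ≤ k → x.1.2 < g (k + 1) x.1.1 := by
        intro h
        rw [hg.stable (k + 1) (by omega), hs]
        exact (mem_cells_straight_iff ν x.1.1 x.1.2).mp x.2
      omega
  refine ⟨T, ⟨?_, ?_⟩, ?_, hT⟩
  · intro x y hi hj
    have := (hT y (T y + 1)).mp (by omega)
    have := (hT x (T y + 1)).mpr (by rw [hi]; omega)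
    omega
  · intro x y hj hi
    have h1 := (hT y (T y + 1)).mp (by omega)
    rw [hT]
    have hanti : Antitone (g (T y)) := antitone_nat_of_succ_le (hg.antitone_row (T y))
    have h2 := hg.interlace (T y) (y.1.1 - 1)
    rw [show y.1.1 - 1 + 1 = y.1.1 by omega] at h2
    have h3 := hanti (show x.1.1 ≤ y.1.1 - 1 by omega)
    omega
  · intro k i
    rw [← hs]
    rcases le_total k K with h | h
    · exact hg.le_of_le h i
    · exact (hg.stable k h i).le

/-- The Kostka number, counted by patterns. -/
theorem ncard_tableaux_eq (ν : YoungDiagram) (m : ℕ →₀ ℕ) {K : ℕ} (hm : ∀ k, m k ≠ 0 → k < K) :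
    Set.ncard {T : (straight ν).cells → ℕ | (straight ν).IsSemistandard T ∧
        (straight ν).content T = m} =
      Set.ncard {g : ℕ → ℕ → ℕ | IsGT K g ∧ (∀ i, g K i = ν.rowLen i) ∧
        ∀ k, ∑ i ∈ Finset.range k, g k i = ∑ j ∈ Finset.range k, m j} := by
  have hK : ∀ T : (straight ν).cells → ℕ, (straight ν).content T = m → ∀ x, T x < K := by
    intro T hT x
    refine hm _ ?_
    rw [← hT, content_apply]
    exact (Finset.card_pos.mpr ⟨x, by simp⟩).ne'
  choose! f hf1 hf2 hf3 using fun (T : (straight ν).cells → ℕ)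
    (hT : (straight ν).IsSemistandard T ∧ (straight ν).content T = m) =>
      hT.1.exists_pattern (hK T hT.2)
  refine Set.ncard_congr (fun T _ => f T) ?_ ?_ ?_
  · intro T hT
    refine ⟨hf1 T hT, hf2 T hT, fun k => ?_⟩
    rw [(hf3 T hT).sum_eq (hf1 T hT), hT.2]
  · intro T T' hT hT' h
    have h1 := hf3 T hT
    rw [h] at h1
    exact h1.eq (hf3 T' hT')
  · rintro g ⟨hg, hs, hc⟩
    obtain ⟨T, hT, hp⟩ := hg.exists_tableau hs
    have hTm : (straight ν).content T = m :=
      Finsupp.eq_of_sum_range_eq fun k => by rw [← hp.sum_eq hg, hc]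
    exact ⟨T, ⟨hT, hTm⟩, (hf3 T ⟨hT, hTm⟩).pattern_eq hp⟩

end SkewShape

/-! ### Fillings of ribbons as words -/

/-- The sum of the first `i` terms. -/
def prefixSum (α : ℕ → ℕ) (i : ℕ) : ℕ := ∑ q ∈ Finset.range i, α q

theorem prefixSum_succ (α : ℕ → ℕ) (i : ℕ) : prefixSum α (i + 1) = prefixSum α i + α i :=
  Finset.sum_range_succ _ _

theorem prefixSum_mono (α : ℕ → ℕ) : Monotone (prefixSum α) :=
  monotone_nat_of_le_succ fun i => by rw [prefixSum_succ]; omega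

theorem exists_prefixSum_le (α : ℕ → ℕ) {t : ℕ} : ∀ {L : ℕ}, t < prefixSum α L →
    ∃ i < L, prefixSum α i ≤ t ∧ t < prefixSum α (i + 1)
  | 0, h => by simp [prefixSum] at h
  | L + 1, h => by
    rcases Nat.lt_or_ge t (prefixSum α L) with h' | h'
    · obtain ⟨i, hi, h1⟩ := exists_prefixSum_le α h'
      exact ⟨i, by omega, h1⟩
    · exact ⟨L, by omega, h', h⟩

theorem prefixSum_index_unique (α : ℕ → ℕ) {t i i' : ℕ} (h1 : prefixSum α i ≤ t)
    (h2 : t < prefixSum α (i + 1)) (h1' : prefixSum α i' ≤ t) (h2' : t < prefixSum α (i' + 1)) :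
    i = i' := by
  by_contra hne
  rcases Nat.lt_or_gt_of_ne hne with h | h
  · have := prefixSum_mono α (show i + 1 ≤ i' by omega)
    omega
  · have := prefixSum_mono α (show i' + 1 ≤ i by omega)
    omega

/-- The positions are divided into consecutive blocks of lengths `α 0, α 1, …`: the relation `d`
fails inside the blocks, and holds at the end of the blocks marked by `δ`. -/
def FitsBlocks (α : ℕ → ℕ) (δ d : ℕ → Prop) : Prop :=
  (∀ i t, prefixSum α i ≤ t → t + 1 < prefixSum α (i + 1) → ¬ d t) ∧
    ∀ i, δ i → d (prefixSum α (i + 1) - 1)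

theorem List.count_eq_card_filter_range (w : List ℕ) (k : ℕ) :
    w.count k = ((Finset.range w.length).filter fun t => w.getD t 0 = k).card := by
  induction w with
  | nil => simp
  | cons x w ih =>
    rw [List.count_cons, ih, List.length_cons, Finset.card_filter, Finset.card_filter,
      Finset.sum_range_succ']
    simp

namespace SkewShape

/-- The rows `i` and `i + 1` overlap. -/
def Overlaps (R : SkewShape) (i : ℕ) : Prop := R.outer.rowLen (i + 1) = R.inner.rowLen i + 1

/-- A ribbon whose row lengths are the parts, all at least two, of a partition with at most `L`
parts. -/
structure IsPartitionRibbon (R : SkewShape) (α : ℕ → ℕ) (L : ℕ) : Prop where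
  outer_eq : ∀ i, R.outer.rowLen i = R.inner.rowLen i + α i
  outer_succ_le : ∀ i, R.outer.rowLen (i + 1) ≤ R.inner.rowLen i + 1
  anti : Antitone α
  two_le : ∀ i, α i ≠ 0 → 2 ≤ α i
  eq_zero : ∀ i, L ≤ i → α i = 0

theorem rowLen_eq (R : SkewShape) (i : ℕ) :
    R.outer.rowLen i = R.inner.rowLen i + R.rowLen i := by
  have hle : R.inner.rowLen i ≤ R.outer.rowLen i := by
    by_contra h
    have h1 : (i, R.outer.rowLen i) ∈ R.inner := YoungDiagram.mem_iff_lt_rowLen.mpr (by omega)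
    have h2 := YoungDiagram.mem_iff_lt_rowLen.mp (R.inner_le_outer h1)
    omega
  have : (R.cells.filter fun c => c.1 = i) =
      (Finset.Ico (R.inner.rowLen i) (R.outer.rowLen i)).map ⟨fun j => (i, j), fun a b h => by
        simpa using h⟩ := by
    ext ⟨a, b⟩
    rw [Finset.mem_filter, mem_cells_iff, Finset.mem_map]
    constructor
    · rintro ⟨h, rfl⟩
      exact ⟨b, Finset.mem_Ico.mpr h, rfl⟩
    · rintro ⟨c, h, he⟩
      obtain ⟨rfl, rfl⟩ := Prod.ext_iff.mp he
      exact ⟨Finset.mem_Ico.mp h, rfl⟩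
  rw [rowLen, this, Finset.card_map, Nat.card_Ico]
  omega

theorem IsRibbon.isPartitionRibbon {R : SkewShape} (hR : R.IsRibbon) {α : ℕ → ℕ}
    (hα : Antitone α) (hα2 : ∀ i, α i ≠ 0 → 2 ≤ α i) (hrow : ∀ i, R.rowLen i = α i) :
    ∃ L, R.IsPartitionRibbon α L := by
  have h1 : ∀ i, R.outer.rowLen i = R.inner.rowLen i + α i := fun i => by
    rw [R.rowLen_eq, hrow]
  refine ⟨R.outer.colLen 0, h1, fun i => ?_, hα, hα2, fun i hi => ?_⟩
  · by_contra hlt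
    have h2 := h1 i
    have h3 := h1 (i + 1)
    have h4 := R.outer.rowLen_anti i (i + 1) (by omega)
    have h5 := R.inner.rowLen_anti i (i + 1) (by omega)
    refine hR ⟨i, R.inner.rowLen i, ?_⟩
    simp only [mem_cells_iff]
    omega
  · have h2 : R.outer.rowLen i = 0 := by
      by_contra h
      have h3 : (i, 0) ∈ R.outer := YoungDiagram.mem_iff_lt_rowLen.mpr (by omega)
      have := YoungDiagram.mem_iff_lt_colLen.mp h3
      omega
    have := h1 i
    omega

namespace IsPartitionRibbon

variable {R : SkewShape} {α : ℕ → ℕ} {L : ℕ}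

theorem overlaps_ne_zero (h : R.IsPartitionRibbon α L) {i : ℕ} (hi : R.Overlaps i) :
    2 ≤ α i ∧ 2 ≤ α (i + 1) := by
  have h1 := h.outer_eq (i + 1)
  have h2 := R.inner.rowLen_anti i (i + 1) (by omega)
  unfold Overlaps at hi
  have h3 := h.two_le (i + 1) (by omega)
  exact ⟨h3.trans (h.anti (by omega)), h3⟩

/-- Consecutive rows share at most one column, so the middle row of three in one column would have a
single box. Parts being at least 2, columns have length at most two. -/
theorem eq_of_mem_column (h : R.IsPartitionRibbon α L) {a b j : ℕ} (hab : a < b)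
    (ha : (a, j) ∈ R.cells) (hb : (b, j) ∈ R.cells) :
    b = a + 1 ∧ R.Overlaps a ∧ j = R.inner.rowLen a := by
  rw [mem_cells_iff] at ha hb
  have h1 := R.outer.rowLen_anti (a + 1) b (by omega)
  have h2 := h.outer_succ_le a
  have ho : R.Overlaps a := by unfold Overlaps; omega
  refine ⟨?_, ho, by omega⟩
  by_contra hne
  have h3 := R.outer.rowLen_anti (a + 1 + 1) b (by omega)
  have h4 := h.outer_succ_le (a + 1)
  have h5 := h.overlaps_ne_zero ho
  have h6 := h.outer_eq (a + 1)
  omega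

theorem mem_of_overlaps (h : R.IsPartitionRibbon α L) {i : ℕ} (hi : R.Overlaps i) :
    (i, R.inner.rowLen i) ∈ R.cells ∧ (i + 1, R.inner.rowLen i) ∈ R.cells := by
  have h1 := h.overlaps_ne_zero hi
  have h2 := h.outer_eq i
  have h3 := R.inner.rowLen_anti i (i + 1) (by omega)
  unfold Overlaps at hi
  simp only [mem_cells_iff]
  omega

/-- A column of length two is the column of the leftmost box of its upper row, and that row
determines it. -/
theorem overlap_eq (h : R.IsPartitionRibbon α L) [DecidablePred R.Overlaps] (i : ℕ) :
    R.overlap i = ((Finset.Ico i L).filter R.Overlaps).card := by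
  symm
  refine Finset.card_bij (fun a _ => R.inner.rowLen a) ?_ ?_ ?_
  · intro a ha
    rw [Finset.mem_filter, Finset.mem_Ico] at ha
    obtain ⟨h1, h2⟩ := h.mem_of_overlaps ha.2
    rw [Finset.mem_filter]
    refine ⟨Finset.mem_image.mpr ⟨_, h1, rfl⟩, ?_⟩
    rw [Finset.card_eq_two]
    refine ⟨(a, R.inner.rowLen a), (a + 1, R.inner.rowLen a), by simp, Finset.ext fun c => ?_⟩
    rw [Finset.mem_filter, Finset.mem_insert, Finset.mem_singleton]
    constructor
    · obtain ⟨b, j⟩ := c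
      rintro ⟨hc, hi, hj⟩
      simp only at hj
      subst hj
      rcases Nat.lt_trichotomy b a with hlt | rfl | hgt
      · have e1 := (h.eq_of_mem_column hlt hc h1).1
        have e2 := (h.eq_of_mem_column (show b < a + 1 by omega) hc h2).1
        omega
      · exact Or.inl rfl
      · obtain rfl := (h.eq_of_mem_column hgt h1 hc).1
        exact Or.inr rfl
    · rintro (rfl | rfl)
      · exact ⟨h1, ha.1.1, rfl⟩
      · exact ⟨h2, by have := ha.1.1; simp only; omega, rfl⟩
  · have key : ∀ a b, R.Overlaps a → R.Overlaps b → a < b →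
        R.inner.rowLen a ≠ R.inner.rowLen b := by
      intro a b ha hb hab he
      have h1 := h.mem_of_overlaps ha
      have h2 := h.mem_of_overlaps hb
      rw [he] at h1
      have e := (h.eq_of_mem_column (show a < b + 1 by omega) h1.1 h2.2).1
      omega
    intro a ha b hb he
    rw [Finset.mem_filter] at ha hb
    by_contra hne
    rcases Nat.lt_or_gt_of_ne hne with hlt | hlt
    · exact key a b ha.2 hb.2 hlt he
    · exact key b a hb.2 ha.2 hlt he.symm
  · intro j hj
    rw [Finset.mem_filter, Finset.card_eq_two] at hj
    obtain ⟨⟨a, j1⟩, ⟨b, j2⟩, hne, heq⟩ := hj.2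
    have h1 : (a, j1) ∈ R.cells ∧ i ≤ a ∧ j1 = j := by
      have : (a, j1) ∈ (R.cells.filter fun c => i ≤ c.1 ∧ c.2 = j) := by rw [heq]; simp
      simpa using this
    have h2 : (b, j2) ∈ R.cells ∧ i ≤ b ∧ j2 = j := by
      have : (b, j2) ∈ (R.cells.filter fun c => i ≤ c.1 ∧ c.2 = j) := by rw [heq]; simp
      simpa using this
    obtain ⟨h1, hia, rfl⟩ := h1
    obtain ⟨h2, hib, rfl⟩ := h2
    have hlt : ∀ a, R.Overlaps a → a < L := by
      intro a ha
      by_contra hL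
      have := h.overlaps_ne_zero ha
      have := h.eq_zero a (by omega)
      omega
    rcases Nat.lt_trichotomy a b with hab | rfl | hab
    · obtain ⟨-, ho, hj⟩ := h.eq_of_mem_column hab h1 h2
      exact ⟨a, by rw [Finset.mem_filter, Finset.mem_Ico]; exact ⟨⟨hia, hlt a ho⟩, ho⟩, hj.symm⟩
    · exact absurd rfl hne
    · obtain ⟨-, ho, hj⟩ := h.eq_of_mem_column hab h2 h1
      exact ⟨b, by rw [Finset.mem_filter, Finset.mem_Ico]; exact ⟨⟨hib, hlt b ho⟩, ho⟩, hj.symm⟩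

end IsPartitionRibbon

/-- The position of a box in the reading of a ribbon by rows, from top to bottom and from right to
left. -/
def readingPos (R : SkewShape) (α : ℕ → ℕ) (c : ℕ × ℕ) : ℕ :=
  prefixSum α c.1 + (R.outer.rowLen c.1 - 1 - c.2)

/-- The filling with a given reading word. -/
def fillingOf (R : SkewShape) (α : ℕ → ℕ) (w : List ℕ) (x : R.cells) : ℕ :=
  w.getD (R.readingPos α x.1) 0

namespace IsPartitionRibbon

variable {R : SkewShape} {α : ℕ → ℕ} {L : ℕ}

theorem readingPos_mem (h : R.IsPartitionRibbon α L) {c : ℕ × ℕ} (hc : c ∈ R.cells) :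
    prefixSum α c.1 ≤ R.readingPos α c ∧ R.readingPos α c < prefixSum α (c.1 + 1) := by
  have h1 := (R.mem_cells_iff c.1 c.2).mp hc
  have h2 := h.outer_eq c.1
  rw [prefixSum_succ]
  unfold readingPos
  omega

theorem readingPos_lt (h : R.IsPartitionRibbon α L) {c : ℕ × ℕ} (hc : c ∈ R.cells) :
    R.readingPos α c < prefixSum α L := by
  refine (h.readingPos_mem hc).2.trans_le (prefixSum_mono α ?_)
  by_contra hL
  have h1 := (R.mem_cells_iff c.1 c.2).mp hc
  have h2 := h.outer_eq c.1
  have := h.eq_zero c.1 (by omega)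
  omega

theorem readingPos_injOn (h : R.IsPartitionRibbon α L) {c c' : ℕ × ℕ} (hc : c ∈ R.cells)
    (hc' : c' ∈ R.cells) (he : R.readingPos α c = R.readingPos α c') : c = c' := by
  have h1 := h.readingPos_mem hc
  have h2 := h.readingPos_mem hc'
  rw [← he] at h2
  have hi := prefixSum_index_unique α h1.1 h1.2 h2.1 h2.2
  have h3 := (R.mem_cells_iff c.1 c.2).mp hc
  have h4 := (R.mem_cells_iff c'.1 c'.2).mp hc'
  unfold readingPos at he
  rw [hi] at he h3
  exact Prod.ext hi (by omega)

theorem exists_cell (h : R.IsPartitionRibbon α L) {i t : ℕ} (h1 : prefixSum α i ≤ t)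
    (h2 : t < prefixSum α (i + 1)) :
    (i, R.outer.rowLen i - 1 - (t - prefixSum α i)) ∈ R.cells ∧
      R.readingPos α (i, R.outer.rowLen i - 1 - (t - prefixSum α i)) = t := by
  have := h.outer_eq i
  rw [prefixSum_succ] at h2
  rw [mem_cells_iff, readingPos]
  refine ⟨by omega, ?_⟩
  simp only
  omega

theorem exists_cell_of_lt (h : R.IsPartitionRibbon α L) {t : ℕ} (ht : t < prefixSum α L) :
    ∃ x : R.cells, R.readingPos α x.1 = t := by
  obtain ⟨i, _, h1, h2⟩ := exists_prefixSum_le α ht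
  exact ⟨⟨_, (h.exists_cell h1 h2).1⟩, (h.exists_cell h1 h2).2⟩

/-- Rows are read from right to left, so weak increase means no rise inside a block. The boxes of a
column of length two are read consecutively, across a block boundary, and strictness there is a
rise. -/
theorem isSemistandard_fillingOf_iff (h : R.IsPartitionRibbon α L) (w : List ℕ) :
    R.IsSemistandard (R.fillingOf α w) ↔ FitsBlocks α R.Overlaps (HasRise w) := by
  have hov : ∀ i, R.Overlaps i → R.readingPos α (i, R.inner.rowLen i) = prefixSum α (i + 1) - 1 ∧
      R.readingPos α (i + 1, R.inner.rowLen i) = prefixSum α (i + 1) - 1 + 1 := by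
    intro i hi
    have h1 := h.overlaps_ne_zero hi
    have h2 := h.outer_eq i
    have h3 := prefixSum_succ α i
    unfold Overlaps at hi
    unfold readingPos
    constructor <;> simp only <;> omega
  constructor
  · intro hT
    refine ⟨fun i t h1 h2 => ?_, fun i hi => ?_⟩
    · obtain ⟨m1, p1⟩ := h.exists_cell h1 (show t < prefixSum α (i + 1) by omega)
      obtain ⟨m2, p2⟩ := h.exists_cell (show prefixSum α i ≤ t + 1 by omega) h2
      have := hT.1 ⟨_, m2⟩ ⟨_, m1⟩ rfl (by simp only; omega)
      simp only [fillingOf, p1, p2] at this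
      exact not_lt.mpr this
    · obtain ⟨m1, m2⟩ := h.mem_of_overlaps hi
      have := hT.2 ⟨_, m1⟩ ⟨_, m2⟩ rfl (Nat.lt_succ_self i)
      simp only [fillingOf, (hov i hi).1, (hov i hi).2] at this
      exact this
  · rintro ⟨hA, hD⟩
    constructor
    · intro x y hi hj
      have hx := h.readingPos_mem x.2
      have hy := h.readingPos_mem y.2
      have hle : R.readingPos α y.1 ≤ R.readingPos α x.1 := by
        unfold readingPos
        rw [hi]
        omega
      have key : ∀ t, R.readingPos α y.1 ≤ t → t < prefixSum α (x.1.1 + 1) →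
          w.getD t 0 ≤ w.getD (R.readingPos α y.1) 0 := by
        intro t ht
        induction t, ht using Nat.le_induction with
        | base => intro _; exact le_rfl
        | succ t ht ih =>
          intro ht'
          exact (not_lt.mp (hA x.1.1 t (by rw [hi]; omega) ht')).trans (ih (by omega))
      exact key _ hle hx.2
    · rintro ⟨⟨a, j⟩, hx⟩ ⟨⟨b, j'⟩, hy⟩ hj hi
      simp only at hj hi
      subst hj
      obtain ⟨rfl, ho, rfl⟩ := h.eq_of_mem_column hi hx hy
      have := hD a ho
      simp only [fillingOf, (hov a ho).1, (hov a ho).2]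
      exact this

theorem content_fillingOf (h : R.IsPartitionRibbon α L) {w : List ℕ}
    (hw : w.length = prefixSum α L) (k : ℕ) :
    R.content (R.fillingOf α w) k = w.count k := by
  rw [content_apply, List.count_eq_card_filter_range, hw]
  refine Finset.card_bij (fun x _ => R.readingPos α x.1) ?_ ?_ ?_
  · intro x hx
    rw [Finset.mem_filter] at hx ⊢
    exact ⟨Finset.mem_range.mpr (h.readingPos_lt x.2), hx.2⟩
  · intro x _ y _ he
    exact Subtype.ext (h.readingPos_injOn x.2 y.2 he)
  · intro t ht
    rw [Finset.mem_filter, Finset.mem_range] at ht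
    obtain ⟨x, hx⟩ := h.exists_cell_of_lt ht.1
    refine ⟨x, ?_, hx⟩
    rw [Finset.mem_filter, fillingOf, hx]
    exact ⟨Finset.mem_univ _, ht.2⟩

theorem ncard_fillings_eq (h : R.IsPartitionRibbon α L) (m : ℕ →₀ ℕ) :
    Set.ncard {T : R.cells → ℕ | R.IsSemistandard T ∧ R.content T = m} =
      Set.ncard {w : List ℕ | w.length = prefixSum α L ∧ FitsBlocks α R.Overlaps (HasRise w) ∧
        ∀ k, w.count k = m k} := by
  symm
  refine Set.ncard_congr (fun w _ => R.fillingOf α w) ?_ ?_ ?_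
  · rintro w ⟨hl, hf, hc⟩
    exact ⟨(h.isSemistandard_fillingOf_iff w).mpr hf,
      Finsupp.ext fun k => by rw [h.content_fillingOf hl, hc]⟩
  · rintro w v ⟨hw, -, -⟩ ⟨hv, -, -⟩ he
    refine List.ext_getElem (hw.trans hv.symm) fun t h1 h2 => ?_
    obtain ⟨x, hx⟩ := h.exists_cell_of_lt (hw ▸ h1)
    have := congrFun he x
    simp only [fillingOf, hx] at this
    rwa [List.getD_eq_getElem _ _ h1, List.getD_eq_getElem _ _ h2] at this
  · rintro T ⟨hT, hc⟩
    choose f hf using fun t : Fin (prefixSum α L) => h.exists_cell_of_lt t.2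
    have hl : (List.ofFn fun t => T (f t)).length = prefixSum α L := by simp
    have hw : R.fillingOf α (List.ofFn fun t => T (f t)) = T := by
      funext x
      have hx := h.readingPos_lt x.2
      rw [fillingOf, List.getD_eq_getElem _ _ (by rw [hl]; exact hx), List.getElem_ofFn]
      congr 1
      exact Subtype.ext (h.readingPos_injOn (f _).2 x.2 (hf _))
    refine ⟨_, ⟨hl, ?_, fun k => ?_⟩, hw⟩
    · rw [← h.isSemistandard_fillingOf_iff, hw]
      exact hT
    · rw [← h.content_fillingOf hl, hw, hc]

end IsPartitionRibbon

end SkewShape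

/-! ### Schur expansions -/

theorem List.finite_length_eq_of_forall_lt (n B : ℕ) :
    {l : List ℕ | l.length = n ∧ ∀ x ∈ l, x < B}.Finite := by
  refine ((List.finite_length_eq (Fin B) n).image (List.map Fin.val)).subset ?_
  rintro l ⟨hl, hB⟩
  refine ⟨l.attach.map fun x => ⟨x.1, hB x.1 x.2⟩, by simpa using hl, ?_⟩
  simp [List.map_map, Function.comp_def]

/-- A letter r forces all of 0, …, r to occur. This makes the set of recording words finite. -/
theorem IsLattice.lt_length {q : List ℕ} (hq : IsLattice q) : ∀ r ∈ q, r < q.length := by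
  have anti : Antitone fun i => q.count i := antitone_nat_of_succ_le hq.count_succ_le
  intro r hr
  by_contra hlt
  have hsub : Finset.range (r + 1) ⊆ q.toFinset := by
    intro i hi
    rw [Finset.mem_range] at hi
    rw [List.mem_toFinset, ← List.count_pos_iff]
    exact (List.count_pos_iff.mpr hr).trans_le (anti (show i ≤ r by omega))
  have h1 := Finset.card_le_card hsub
  have h2 := q.toFinset_card_le
  rw [Finset.card_range] at h1
  omega

theorem exists_youngDiagram {f : ℕ → ℕ} (hf : Antitone f) {N : ℕ} (hN : f N = 0) :
    ∃ ν : YoungDiagram, ν.rowLen = f := by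
  let ν : YoungDiagram :=
    { cells := (Finset.range N ×ˢ Finset.range (f 0)).filter fun c => c.2 < f c.1
      isLowerSet := by
        rintro ⟨a, b⟩ ⟨a', b'⟩ hle hab
        obtain ⟨h1, h2⟩ := Prod.mk_le_mk.mp hle
        simp only [Finset.coe_filter, Finset.mem_product, Finset.mem_range,
          Set.mem_ofPred_eq] at hab ⊢
        have := hf h1
        have := hf (Nat.zero_le a')
        omega }
  have hν : ∀ i j, (i, j) ∈ ν ↔ j < f i := by
    intro i j
    rw [← YoungDiagram.mem_cells]
    simp only [ν, Finset.mem_filter, Finset.mem_product, Finset.mem_range]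
    refine ⟨fun h => h.2, fun h => ⟨⟨?_, h.trans_le (hf (Nat.zero_le i))⟩, h⟩⟩
    by_contra hi
    have := hf (not_lt.mp hi)
    omega
  refine ⟨ν, funext fun i => ?_⟩
  have h1 := hν i (f i)
  have h2 := hν i (ν.rowLen i)
  rw [YoungDiagram.mem_iff_lt_rowLen] at h1 h2
  omega

theorem IsLattice.exists_shape {q : List ℕ} (hq : IsLattice q) :
    ∃ ν : YoungDiagram, ν.rowLen = fun i => q.count i :=
  exists_youngDiagram (antitone_nat_of_succ_le hq.count_succ_le) (N := q.length)
    (List.count_eq_zero.mpr fun h => lt_irrefl _ (hq.lt_length _ h))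

theorem YoungDiagram.eq_of_rowLen_eq {μ ν : YoungDiagram} (h : μ.rowLen = ν.rowLen) : μ = ν := by
  ext ⟨i, j⟩
  rw [YoungDiagram.mem_cells, YoungDiagram.mem_cells, YoungDiagram.mem_iff_lt_rowLen,
    YoungDiagram.mem_iff_lt_rowLen, h]

theorem YoungDiagram.rowLen_eq_zero (ν : YoungDiagram) {i : ℕ} (hi : ν.colLen 0 ≤ i) :
    ν.rowLen i = 0 := by
  by_contra h
  have h1 : (i, 0) ∈ ν := YoungDiagram.mem_iff_lt_rowLen.mpr (by omega)
  have := YoungDiagram.mem_iff_lt_colLen.mp h1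
  omega

theorem sum_range_eq_of_count {w : List ℕ} {m : ℕ → ℕ} :
    (∀ k, w.count k = m k) ↔ ∀ k, w.countP (· < k) = ∑ j ∈ Finset.range k, m j := by
  have hsucc : ∀ k, w.countP (· < k + 1) = w.countP (· < k) + w.count k := by
    intro k
    induction w with
    | nil => simp
    | cons x w ih =>
      rw [List.countP_cons, List.countP_cons, List.count_cons, ih]
      by_cases h1 : x < k
      · simp [h1, h1.ne, show x < k + 1 by omega]
        omega
      · by_cases h2 : x = k
        · simp [h2]
          omega
        · simp [h1, h2, show ¬ x < k + 1 by omega]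
  constructor
  · intro h k
    induction k with
    | zero => simp
    | succ k ih => rw [hsucc, ih, h, Finset.sum_range_succ]
  · intro h k
    have h1 := h (k + 1)
    rw [hsucc, h, Finset.sum_range_succ] at h1
    omega

namespace SkewShape

/-- The lattice words which are recording words of the fillings of a ribbon. -/
def recordingWords (R : SkewShape) (α : ℕ → ℕ) (L : ℕ) : Set (List ℕ) :=
  {q | q.length = prefixSum α L ∧ IsLattice q ∧
    FitsBlocks α R.Overlaps fun t => q.getD (t + 1) 0 < q.getD t 0}

variable {R : SkewShape} {α : ℕ → ℕ} {L : ℕ}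

theorem finite_recordingWords (R : SkewShape) (α : ℕ → ℕ) (L : ℕ) :
    (R.recordingWords α L).Finite :=
  (List.finite_length_eq_of_forall_lt (prefixSum α L) (prefixSum α L)).subset
    fun _ hq => ⟨hq.1, fun r hr => hq.1 ▸ hq.2.1.lt_length r hr⟩

/-- Blocks from L on are empty and a marked block is followed by a nonempty one, so the default
value of `getD` past the end of a word is never consulted. -/
theorem fitsBlocks_congr {R : SkewShape} (h : R.IsPartitionRibbon α L) {d d' : ℕ → Prop}
    (hd : ∀ t, t + 1 < prefixSum α L → (d t ↔ d' t)) :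
    FitsBlocks α R.Overlaps d ↔ FitsBlocks α R.Overlaps d' := by
  have hle : ∀ i, prefixSum α i ≤ prefixSum α L := by
    intro i
    rcases le_total i L with hi | hi
    · exact prefixSum_mono α hi
    · induction i, hi using Nat.le_induction with
      | base => exact le_rfl
      | succ i hi ih => rw [prefixSum_succ, h.eq_zero i hi]; exact ih
  refine and_congr ?_ ?_
  · refine forall_congr' fun i => forall_congr' fun t => forall_congr' fun _ =>
      forall_congr' fun h2 => not_congr (hd t (h2.trans_le (hle _)))
  · refine forall_congr' fun i => forall_congr' fun hi => hd _ ?_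
    have h1 := h.overlaps_ne_zero hi
    have h2 := hle (i + 1 + 1)
    have h3 := prefixSum_succ α (i + 1)
    have h4 := prefixSum_succ α i
    omega

/-- The words are sorted by recording word. The block conditions depend on the recording word alone,
so each fibre is the full set of patterns of its shape and content. -/
theorem IsPartitionRibbon.ncard_words_eq (h : R.IsPartitionRibbon α L) (m : ℕ →₀ ℕ)
    {K : ℕ} (hm : ∀ k, m k ≠ 0 → k < K) :
    Set.ncard {w : List ℕ | w.length = prefixSum α L ∧ FitsBlocks α R.Overlaps (HasRise w) ∧
        ∀ k, w.count k = m k} =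
      ∑ q ∈ (finite_recordingWords R α L).toFinset,
        Set.ncard {g : ℕ → ℕ → ℕ | IsGT K g ∧ (∀ i, g K i = q.count i) ∧
          ∀ k, ∑ i ∈ Finset.range k, g k i = ∑ j ∈ Finset.range k, m j} := by
  classical
  set X := {w : List ℕ | w.length = prefixSum α L ∧ FitsBlocks α R.Overlaps (HasRise w) ∧
        ∀ k, w.count k = m k} with hX
  have hlt : ∀ w : List ℕ, (∀ k, w.count k = m k) → ∀ x ∈ w, x < K := fun w hw x hx =>
    hm x (by rw [← hw]; exact (List.count_pos_iff.mpr hx).ne')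
  have hfin : X.Finite := (List.finite_length_eq_of_forall_lt (prefixSum α L) K).subset
    fun w hw => ⟨hw.1, hlt w hw.2.2⟩
  have hfits : ∀ w : List ℕ, (∀ x ∈ w, x < K) → w.length = prefixSum α L →
      (FitsBlocks α R.Overlaps (HasRise w) ↔ FitsBlocks α R.Overlaps fun t =>
        (recordingWord K w).getD (t + 1) 0 < (recordingWord K w).getD t 0) :=
    fun w hw hl => fitsBlocks_congr h fun t ht => hasRise_iff_recordingWord hw t (hl ▸ ht)
  rw [Set.ncard_eq_toFinset_card X hfin,
    Finset.card_eq_sum_card_fiberwise (f := recordingWord K)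
      (t := (finite_recordingWords R α L).toFinset)]
  · refine Finset.sum_congr rfl fun q hq => ?_
    rw [Set.Finite.mem_toFinset] at hq
    rw [← Set.ncard_coe_finset]
    refine Set.ncard_congr (fun w _ => insertionPattern w) ?_ ?_ ?_
    · intro w hw
      simp only [Finset.coe_filter, Set.Finite.mem_toFinset, Set.mem_ofPred_eq] at hw
      obtain ⟨⟨-, -, hc⟩, rfl⟩ := hw
      refine ⟨isGT_insertionPattern (hlt w hc), count_recordingWord (hlt w hc), fun k => ?_⟩
      rw [sum_insertionPattern, sum_range_eq_of_count.mp hc]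
    · intro w v hw hv he
      simp only [Finset.coe_filter, Set.Finite.mem_toFinset, Set.mem_ofPred_eq] at hw hv
      exact word_unique (hlt w hw.1.2.2) (hlt v hv.1.2.2) (hw.2.trans hv.2.symm) he
    · rintro g ⟨hg, hs, hc⟩
      obtain ⟨w, hw, rfl, rfl⟩ := exists_word hq.2.1 hg hs
      refine ⟨w, ?_, rfl⟩
      have hl : w.length = prefixSum α L := by rw [← length_recordingWord K, hq.1]
      simp only [Finset.coe_filter, Set.Finite.mem_toFinset, Set.mem_ofPred_eq]
      refine ⟨⟨hl, (hfits w hw hl).mpr hq.2.2, sum_range_eq_of_count.mpr fun k => ?_⟩, trivial⟩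
      rw [← sum_insertionPattern, hc]
  · intro w hw
    rw [Finset.mem_coe, Set.Finite.mem_toFinset] at hw ⊢
    have hw' := hlt w hw.2.2
    exact ⟨by rw [length_recordingWord, hw.1], isLattice_recordingWord hw',
      (hfits w hw' hw.1).mp hw.2.1⟩

theorem IsPartitionRibbon.exists_schurExpansion (h : R.IsPartitionRibbon α L) :
    ∃ c : YoungDiagram →₀ ℚ, R.IsSchurExpansion c ∧ ∀ ν : YoungDiagram,
      0 < c ν ↔ ∃ q ∈ R.recordingWords α L, ∀ i, q.count i = ν.rowLen i := by
  classical
  choose! sh hsh using fun q (hq : IsLattice q) => hq.exists_shape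
  set Q := (finite_recordingWords R α L).toFinset
  have hQm : ∀ q, q ∈ Q ↔ q ∈ R.recordingWords α L := fun q => Set.Finite.mem_toFinset _
  refine ⟨∑ q ∈ Q, Finsupp.single (sh q) 1, ?_, fun ν => ?_⟩
  · unfold IsSchurExpansion
    rw [← Finsupp.sum_finsetSum_index (h := fun ν a => a • (straight ν).schurFunction)
      (fun ν => zero_smul ℚ _) (fun ν a b => add_smul a b _)]
    simp only [zero_smul, Finsupp.sum_single_index, one_smul]
    ext m
    rw [map_sum]
    change R.schurFunction m = ∑ q ∈ Q, (straight (sh q)).schurFunction m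
    unfold schurFunction
    obtain ⟨K, hK⟩ : ∃ K, ∀ k, m k ≠ 0 → k < K := ⟨m.support.sup id + 1, fun k hk =>
      Nat.lt_succ_of_le (Finset.le_sup (f := id) (Finsupp.mem_support_iff.mpr hk))⟩
    rw [h.ncard_fillings_eq, h.ncard_words_eq m hK, Nat.cast_sum]
    refine Finset.sum_congr rfl fun q hq => ?_
    rw [ncard_tableaux_eq _ m hK]
    simp only [hsh q ((hQm q).mp hq).2.1]
  · rw [Finsupp.finsetSum_apply]
    simp only [Finsupp.single_apply]
    rw [Finset.sum_boole, Nat.cast_pos, Finset.card_pos]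
    constructor
    · rintro ⟨q, hq⟩
      rw [Finset.mem_filter] at hq
      have hq' := (hQm q).mp hq.1
      exact ⟨q, hq', fun i => by rw [← hq.2, hsh q hq'.2.1]⟩
    · rintro ⟨q, hq, hν⟩
      refine ⟨q, Finset.mem_filter.mpr ⟨(hQm q).mpr hq, ?_⟩⟩
      exact YoungDiagram.eq_of_rowLen_eq (by rw [hsh q hq.2.1]; exact funext hν)

/-! ### Linear independence of Schur functions -/

/-- The monomial `x^ν`, as an exponent vector. -/
noncomputable def rowContent (ν : YoungDiagram) : ℕ →₀ ℕ :=
  Finsupp.onFinset (Finset.range (ν.colLen 0)) ν.rowLen fun i hi => by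
    rw [Finset.mem_range]
    by_contra h
    exact hi (ν.rowLen_eq_zero (not_lt.mp h))

theorem finite_tableaux (A : SkewShape) (m : ℕ →₀ ℕ) :
    {T : A.cells → ℕ | A.IsSemistandard T ∧ A.content T = m}.Finite := by
  classical
  refine (Set.Finite.pi' (fun _ : A.cells => m.support.finite_toSet)).subset ?_
  rintro T ⟨-, hT⟩ x
  rw [Finset.mem_coe, Finsupp.mem_support_iff, ← hT, content_apply]
  exact (Finset.card_pos.mpr ⟨x, by simp⟩).ne'

theorem schurFunction_rowContent_pos (ν : YoungDiagram) :
    0 < (straight ν).schurFunction (rowContent ν) := by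
  unfold schurFunction
  rw [Nat.cast_pos, Set.ncard_pos (finite_tableaux _ _)]
  refine ⟨fun x => x.1.1, ⟨fun x y h _ => h.le, fun x y _ h => h⟩, ?_⟩
  ext k
  rw [content_apply]
  change _ = ν.rowLen k
  rw [← Finset.card_range (ν.rowLen k)]
  refine Finset.card_bij (fun x _ => x.1.2) ?_ ?_ ?_
  · intro x hx
    rw [Finset.mem_filter] at hx
    rw [Finset.mem_range, ← hx.2]
    exact (mem_cells_straight_iff ν x.1.1 x.1.2).mp x.2
  · intro x hx y hy he
    rw [Finset.mem_filter] at hx hy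
    exact Subtype.ext (Prod.ext (hx.2.trans hy.2.symm) he)
  · intro j hj
    exact ⟨⟨(k, j), (mem_cells_straight_iff ν k j).mpr (Finset.mem_range.mp hj)⟩, by simp, rfl⟩

theorem sum_rowLen_le_of_schurFunction_ne_zero {μ ν : YoungDiagram}
    (h : (straight μ).schurFunction (rowContent ν) ≠ 0) (k : ℕ) :
    ∑ i ∈ Finset.range k, ν.rowLen i ≤ ∑ i ∈ Finset.range k, μ.rowLen i := by
  unfold schurFunction at h
  rw [Nat.cast_ne_zero, ← Nat.pos_iff_ne_zero, Set.ncard_pos (finite_tableaux _ _)] at h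
  obtain ⟨T, hT, hc⟩ := h
  obtain ⟨g, hg, -, hp⟩ := hT.exists_pattern (K := Finset.univ.sup T + 1) fun x =>
    Nat.lt_succ_of_le (Finset.le_sup (f := T) (Finset.mem_univ x))
  have := hp.sum_eq hg k
  rw [hc] at this
  change _ = ∑ i ∈ Finset.range k, ν.rowLen i at this
  rw [← this]
  exact Finset.sum_le_sum fun i _ => hp.1 k i

/-- Kostka numbers are triangular for dominance. The sum Φ of partial sums is monotone in dominance,
and strictly so on the support; at a maximizer ν of Φ only s_ν contributes to the coefficient of
x^ν. -/
theorem eq_zero_of_sum_schurFunction_eq_zero (e : YoungDiagram →₀ ℚ)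
    (h : (e.sum fun ν a => a • (straight ν).schurFunction) = 0) : e = 0 := by
  by_contra hne
  let N := e.support.sup fun ν => ν.colLen 0
  let Φ : YoungDiagram → ℕ := fun ν =>
    ∑ k ∈ Finset.range (N + 1), ∑ i ∈ Finset.range k, ν.rowLen i
  obtain ⟨ν, hν, hmax⟩ := Finset.exists_max_image e.support Φ (Finsupp.support_nonempty_iff.mpr hne)
  have h1 := congrArg (MvPowerSeries.coeff (rowContent ν)) h
  rw [Finsupp.sum, map_sum, map_zero, Finset.sum_eq_single ν] at h1
  · rw [map_smul, smul_eq_mul] at h1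
    rcases mul_eq_zero.mp h1 with h2 | h2
    · exact Finsupp.mem_support_iff.mp hν h2
    · exact (schurFunction_rowContent_pos ν).ne' h2
  · intro μ hμ hμν
    rw [map_smul, smul_eq_mul]
    by_contra hcoeff
    have hle := sum_rowLen_le_of_schurFunction_ne_zero (right_ne_zero_of_mul hcoeff)
    have heq := (Finset.sum_eq_sum_iff_of_le fun k _ => hle k).mp
      (le_antisymm (Finset.sum_le_sum fun k _ => hle k) (hmax μ hμ))
    refine hμν (YoungDiagram.eq_of_rowLen_eq (funext fun i => ?_))
    rcases Nat.lt_or_ge i N with hi | hi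
    · have e1 := heq i (Finset.mem_range.mpr (by omega))
      have e2 := heq (i + 1) (Finset.mem_range.mpr (by omega))
      rw [Finset.sum_range_succ, Finset.sum_range_succ] at e2
      omega
    · rw [μ.rowLen_eq_zero ((Finset.le_sup (f := fun ν => ν.colLen 0) hμ).trans hi),
        ν.rowLen_eq_zero ((Finset.le_sup (f := fun ν => ν.colLen 0) hν).trans hi)]
  · intro hn
    exact absurd hν hn

theorem IsSchurExpansion.unique {A : SkewShape} {c c' : YoungDiagram →₀ ℚ}
    (h : A.IsSchurExpansion c) (h' : A.IsSchurExpansion c') : c = c' := by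
  rw [← sub_eq_zero]
  apply eq_zero_of_sum_schurFunction_eq_zero
  rw [Finsupp.sum_sub_index fun ν a b => sub_smul a b _, ← h, ← h', sub_self]

theorem IsPartitionRibbon.mem_schurSupport_iff (h : R.IsPartitionRibbon α L) (ν : YoungDiagram) :
    ν ∈ R.schurSupport ↔ ∃ q ∈ R.recordingWords α L, ∀ i, q.count i = ν.rowLen i := by
  obtain ⟨c, hc, hpos⟩ := h.exists_schurExpansion
  rw [← hpos]
  constructor
  · rintro ⟨c', hc', hν⟩
    rwa [hc.unique hc']
  · exact fun hν => ⟨c, hc, hν⟩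

end SkewShape

/-! ### Horizontal strips with prescribed sizes -/

/-- Row lengths `α` with tail sums `S`, and marked positions `δ` whose tails have `p i` elements. -/
structure IsRowData (α S p : ℕ → ℕ) (δ : ℕ → Prop) (L : ℕ) : Prop where
  S_eq : ∀ i, S i = α i + S (i + 1)
  p_eq : ∀ i, (δ i ∧ p i = p (i + 1) + 1) ∨ (¬ δ i ∧ p i = p (i + 1))
  anti : Antitone α
  two_le : ∀ i, i < L → 2 ≤ α i
  S_eq_zero : ∀ i, L ≤ i → S i = 0
  p_eq_zero : ∀ i, L ≤ i + 1 → p i = 0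

/-- A partition `ν` with tail sums `N` which dominates the rows and satisfies the bounds
`ν i ≤ S i - p i`. -/
structure IsAdmissible (S p ν N : ℕ → ℕ) : Prop where
  anti : Antitone ν
  N_eq : ∀ i, N i = ν i + N (i + 1)
  N_le : ∀ i, N i ≤ S i
  N_zero : N 0 = S 0
  cap : ∀ i, ν i + p i ≤ S i

namespace IsRowData

variable {α S p : ℕ → ℕ} {δ : ℕ → Prop} {L : ℕ}

theorem succ (h : IsRowData α S p δ (L + 1)) :
    IsRowData (fun i => α (i + 1)) (fun i => S (i + 1)) (fun i => p (i + 1))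
      (fun i => δ (i + 1)) L where
  S_eq i := h.S_eq (i + 1)
  p_eq i := h.p_eq (i + 1)
  anti _ _ hab := h.anti (by omega)
  two_le i hi := h.two_le (i + 1) (by omega)
  S_eq_zero i hi := h.S_eq_zero (i + 1) (by omega)
  p_eq_zero i hi := h.p_eq_zero (i + 1) (by omega)

theorem two_mul_le (h : IsRowData α S p δ L) (i : ℕ) : 2 * (L - i) ≤ S i := by
  rcases Nat.lt_or_ge i L with hi | hi
  · obtain ⟨d, rfl⟩ := Nat.exists_eq_add_of_le hi
    induction d generalizing i with
    | zero =>
      have := h.S_eq i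
      have := h.two_le i (by omega)
      omega
    | succ d ih =>
      have := ih (i + 1) (by rwa [show i + 1 + 1 + d = i + 1 + (d + 1) by omega]) (by omega)
      have := h.S_eq i
      have := h.two_le i (by omega)
      omega
  · omega

theorem p_le (h : IsRowData α S p δ L) (i : ℕ) : p i ≤ L - (i + 1) := by
  rcases Nat.lt_or_ge i L with hi | hi
  · obtain ⟨d, rfl⟩ := Nat.exists_eq_add_of_le hi
    induction d generalizing i with
    | zero => rw [h.p_eq_zero i (by omega)]; omega
    | succ d ih =>
      have := ih (i + 1) (by rwa [show i + 1 + 1 + d = i + 1 + (d + 1) by omega]) (by omega)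
      have := h.p_eq i
      omega
  · rw [h.p_eq_zero i (by omega)]; omega

theorem le_sub (h : IsRowData α S p δ L) (i : ℕ) : p i ≤ S i ∧ L - i ≤ S i - p i := by
  have := h.two_mul_le i
  have := h.p_le i
  omega

theorem prefixSum_add (h : IsRowData α S p δ L) (i : ℕ) : prefixSum α i + S i = S 0 := by
  induction i with
  | zero => simp [prefixSum]
  | succ i ih => rw [prefixSum_succ]; have := h.S_eq i; omega

end IsRowData

theorem prefixSum_succ_left (α : ℕ → ℕ) (i : ℕ) :
    prefixSum α (i + 1) = α 0 + prefixSum (fun j => α (j + 1)) i := by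
  rw [prefixSum, Finset.sum_range_succ', add_comm, prefixSum]

theorem mul_le_prefixSum {ν : ℕ → ℕ} (hν : Antitone ν) (i : ℕ) : i * ν i ≤ prefixSum ν i := by
  have := Finset.card_nsmul_le_sum (Finset.range i) ν (ν i)
    fun j hj => hν (Finset.mem_range.mp hj).le
  simpa [prefixSum] using this

theorem prefixSum_le_mul {ν : ℕ → ℕ} (hν : Antitone ν) (i : ℕ) : prefixSum ν i ≤ i * ν 0 := by
  have := Finset.sum_le_card_nsmul (Finset.range i) ν (ν 0) fun j _ => hν (Nat.zero_le j)
  simpa [prefixSum] using this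

theorem prefixSum_add_sum_Ico (u : ℕ → ℕ) {a b : ℕ} (h : a ≤ b) :
    prefixSum u a + ∑ j ∈ Finset.Ico a b, u j = prefixSum u b :=
  Finset.sum_range_add_sum_Ico u h

theorem sub_le_sum_Ico {u : ℕ → ℕ} {a b : ℕ} (h : ∀ j, a ≤ j → j < b → 1 ≤ u j) :
    b - a ≤ ∑ j ∈ Finset.Ico a b, u j := by
  have := Finset.card_nsmul_le_sum (Finset.Ico a b) u 1 fun j hj => by
    rw [Finset.mem_Ico] at hj
    exact h j hj.1 hj.2
  simpa using this

namespace IsAdmissible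

variable {α S p ν N : ℕ → ℕ} {δ : ℕ → Prop} {L : ℕ}

theorem prefixSum_add (hN : IsAdmissible S p ν N) (i : ℕ) : prefixSum ν i + N i = S 0 := by
  induction i with
  | zero => simp [prefixSum, hN.N_zero]
  | succ i ih => rw [prefixSum_succ]; have := hN.N_eq i; omega

theorem eq_zero (h : IsRowData α S p δ L) (hN : IsAdmissible S p ν N) {i : ℕ} (hi : L ≤ i) :
    ν i = 0 ∧ N i = 0 := by
  have := hN.N_le i
  have := h.S_eq_zero i hi
  have := hN.N_eq i
  omega

theorem pos_of_N_pos (h : IsRowData α S p δ L) (hN : IsAdmissible S p ν N) {i : ℕ}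
    (hi : 0 < N i) : 0 < ν i := by
  by_contra h0
  have key : ∀ d, N (i + d) = N i := by
    intro d
    induction d with
    | zero => rfl
    | succ d ih =>
      have := hN.N_eq (i + d)
      have := hN.anti (show i ≤ i + d by omega)
      rw [← add_assoc]
      omega
  have := key L
  have := (hN.eq_zero h (show L ≤ i + L by omega)).2
  omega

/-- Past the rows of maximal length, dominance has some slack. -/
theorem N_lt (h : IsRowData α S p δ L) (hN : IsAdmissible S p ν N) {i : ℕ} (hi : ν i < ν 0) :
    N i < α 0 + S (i + 1) := by
  -- Failure forces α i = α 0 and N i = S i, so the first i rows of ν hold at most i * α 0 boxes.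
  -- But they are at least ν i ≥ α 0 long, and ν 0 is longer.
  by_contra hc
  have h1 := hN.N_le i
  have h2 := h.S_eq i
  have h3 := h.anti (Nat.zero_le i)
  have h4 := hN.N_le (i + 1)
  have h5 := hN.N_eq i
  have h6 := hN.prefixSum_add i
  have h7 := h.prefixSum_add i
  have h8 := prefixSum_le_mul h.anti i
  cases i with
  | zero => omega
  | succ i =>
    have h9 := mul_le_prefixSum (ν := fun j => ν (j + 1)) (fun a b hab => hN.anti (by omega)) i
    rw [prefixSum_succ_left ν] at h6
    have h10 : i * α 0 ≤ i * ν (i + 1) := Nat.mul_le_mul_left i (by omega)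
    rw [Nat.succ_mul] at h8
    omega

/-- The bounds for the rows of the partition that is left after removal of a horizontal strip with
a box in row `m`. -/
theorem le_prefixSum_add (h : IsRowData α S p δ L) (hN : IsAdmissible S p ν N) {m : ℕ}
    (hpos : 0 < ν 0) (hm : ∀ i ≤ m, ν i = ν 0) (hm' : ν (m + 1) < ν 0) {u : ℕ → ℕ}
    (hu : ∀ j, u j = min (if j = m then ν j - 1 else ν j) (S (j + 1) - p (j + 1))) (i : ℕ) :
    S 1 ≤ prefixSum u i + S (i + 1) := by
  have hlt : ∀ i, m < i → ν i < ν 0 := fun i hi => (hN.anti hi).trans_lt hm'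
  -- without rows above the bounds
  have hA : ∀ i, (∀ j < i, ν j ≤ S (j + 1) - p (j + 1)) →
      prefixSum u i + (if m < i then 1 else 0) = prefixSum ν i := by
    intro i hi
    induction i with
    | zero => simp [prefixSum]
    | succ i ih =>
      have h1 := ih fun j hj => hi j (by omega)
      have h2 := hi i (by omega)
      rw [prefixSum_succ, prefixSum_succ, ← h1, hu]
      rcases Nat.lt_trichotomy i m with h3 | rfl | h3
      · simp [h3.ne, show ¬ m < i by omega, show ¬ m < i + 1 by omega, h2]
      · have := hm i le_rfl
        simp
        omega
      · simp [h3.ne', h3, show m < i + 1 by omega, h2]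
        omega
  have hslack : ∀ i, N i + (if m < i then 1 else 0) ≤ α 0 + S (i + 1) := by
    intro i
    split_ifs with hi
    · exact hN.N_lt h (hlt i hi)
    · have := hN.N_le i
      have := h.S_eq i
      have := h.anti (Nat.zero_le i)
      omega
  have hS0 := h.S_eq 0
  by_cases hex : ∀ j < i, ν j ≤ S (j + 1) - p (j + 1)
  · have h1 := hA i hex
    have h2 := hN.prefixSum_add i
    have h3 := hslack i
    simp only [zero_add] at hS0
    omega
  · push Not at hex
    -- Let k be the first row that must be cut down to the bound. By the slack at k, it suffices
    -- that rows k + 1, …, i - 1 of u and the tail S (i + 1) together make up for p (k + 1).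
    obtain ⟨k, ⟨hki, hk⟩, hmin⟩ : ∃ k, (k < i ∧ S (k + 1) - p (k + 1) < ν k) ∧
        ∀ j < k, ν j ≤ S (j + 1) - p (j + 1) := by
      classical
      refine ⟨Nat.find hex, Nat.find_spec hex, fun j hj => ?_⟩
      have h1 := Nat.find_min hex hj
      have h2 := (Nat.find_spec hex).1
      by_contra h3
      exact h1 ⟨by omega, by omega⟩
    have hCanti : ∀ j, S (j + 1 + 1) - p (j + 1 + 1) ≤ S (j + 1) - p (j + 1) := by
      intro j
      have h1 := h.S_eq (j + 1)
      have h2 := h.p_eq (j + 1)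
      rcases Nat.lt_or_ge (j + 1) L with h3 | h3
      · have := h.two_le (j + 1) h3
        omega
      · have := h.S_eq_zero (j + 1 + 1) (by omega)
        omega
    have hCanti' : Antitone fun j => S (j + 1) - p (j + 1) := antitone_nat_of_succ_le hCanti
    have huk : ∀ j, k ≤ j → u j = min (ν j) (S (j + 1) - p (j + 1)) := by
      intro j hj
      rw [hu]
      split_ifs with hjm
      · subst hjm
        have h1 := hm k hj
        have h2 := hm j le_rfl
        have h3 : S (j + 1) - p (j + 1) ≤ S (k + 1) - p (k + 1) := hCanti' hj
        omega
      · rfl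
    have hWk := hA k hmin
    have hW : prefixSum u i = prefixSum u k + (S (k + 1) - p (k + 1)) +
        ∑ j ∈ Finset.Ico (k + 1) i, u j := by
      rw [← prefixSum_add_sum_Ico u (show k + 1 ≤ i by omega), prefixSum_succ, huk k le_rfl,
        min_eq_right hk.le]
    have hνk := hN.prefixSum_add k
    have hsk := hslack k
    have hCk := h.le_sub (k + 1)
    simp only [zero_add] at hS0
    by_cases ha : p (k + 1) ≤ ∑ j ∈ Finset.Ico (k + 1) i, u j + S (i + 1)
    · omega
    · have hpk := h.p_le (k + 1)
      -- If they do not, ν must end above row i and need no cut between k and i: nonempty rows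
      -- contribute at least 1 each to u, parts of α at least 2, and p (k + 1) ≤ L - (k + 2).
      have hNi : N i = 0 := by
        by_contra hne
        have hiL : i < L := by
          by_contra hL
          exact hne (hN.eq_zero h (not_lt.mp hL)).2
        have h1 := hN.pos_of_N_pos h (Nat.pos_of_ne_zero hne)
        have h2 := sub_le_sum_Ico (u := u) (a := k + 1) (b := i) fun j hj hji => by
          rw [huk j (by omega)]
          have := hN.anti hji.le
          have := (h.le_sub (j + 1)).2
          omega
        have h3 := h.two_mul_le (i + 1)
        omega
      have hle : ∀ j, k + 1 ≤ j → j < i → ν j ≤ S (j + 1) - p (j + 1) := by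
        intro k' hk' hk'i
        by_contra hgt
        have hk'L : k' < L := by
          by_contra hL
          have := (hN.eq_zero h (not_lt.mp hL)).1
          omega
        have h2 := sub_le_sum_Ico (u := u) (a := k + 1) (b := k') fun j hj hjk => by
          rw [huk j (by omega)]
          have := hN.anti hjk.le
          have := (h.le_sub (j + 1)).2
          omega
        have h3 := (h.le_sub (k' + 1)).2
        have h4 := huk k' (by omega)
        have h5 := Finset.sum_Ico_consecutive u hk' hk'i.le
        have h6 := Finset.sum_eq_sum_Ico_succ_bot hk'i u
        omega
      have hsum : ∑ j ∈ Finset.Ico (k + 1) i, u j = ∑ j ∈ Finset.Ico (k + 1) i, ν j :=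
        Finset.sum_congr rfl fun j hj => by
          rw [Finset.mem_Ico] at hj
          rw [huk j (by omega), min_eq_left (hle j hj.1 hj.2)]
      have hν : prefixSum ν i = prefixSum ν k + ν k + ∑ j ∈ Finset.Ico (k + 1) i, ν j := by
        rw [← prefixSum_add_sum_Ico ν (show k + 1 ≤ i by omega), prefixSum_succ]
      have hνi := hN.prefixSum_add i
      have hcap := hN.cap k
      have hSk := h.S_eq k
      have hp := h.p_eq k
      have hα := h.anti (Nat.zero_le k)
      -- All boxes of ν are now accounted for, and only the box taken from row m can be missing.
      -- Then ν k attains its cap and α k = α 0, so k + 1 ≥ 2 rows have length at least α 0 + S (k +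
      -- 1) - p (k + 1). That is too many boxes, as 2 * p (k + 1) < S (k + 1).
      by_contra hlt'
      have hmk : m < k := by
        by_contra hmk
        rw [if_neg hmk] at hWk
        omega
      rw [if_pos hmk] at hWk
      have hkL : k + 1 < L := by omega
      have h2S := h.two_mul_le (k + 1)
      have h1 := mul_le_prefixSum hN.anti k
      have h2 := prefixSum_le_mul h.anti k
      have h3 := h.prefixSum_add k
      obtain ⟨D, hD⟩ : ∃ D, ν k = α 0 + D := ⟨ν k - α 0, by omega⟩
      have h4 : 1 * D ≤ k * D := Nat.mul_le_mul_right D (by omega)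
      rw [hD, Nat.mul_add] at h1
      omega

/-- Removal of a horizontal strip: the rest is again admissible, and the strip has a box in the
lowest row of maximal length. -/
theorem exists_strip (h : IsRowData α S p δ (L + 1)) (hN : IsAdmissible S p ν N) :
    ∃ κ M, IsAdmissible (fun i => S (i + 1)) (fun i => p (i + 1)) κ M ∧
      (∀ i, ν (i + 1) ≤ κ i ∧ κ i ≤ ν i) ∧ (∃ m, κ m < ν m ∧ ∀ i ≤ m, ν i = ν 0) ∧
      (δ 0 → ∃ b, 1 ≤ b ∧ κ b < ν b) := by
  have hS0 := h.S_eq 0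
  have hα0 := h.two_le 0 (by omega)
  have hN0 := hN.N_zero
  simp only [zero_add] at hS0
  have hpos : 0 < ν 0 := hN.pos_of_N_pos h (by omega)
  have hex : ∃ m, ν (m + 1) < ν 0 :=
    ⟨L, by rw [(hN.eq_zero h (le_refl (L + 1))).1]; exact hpos⟩
  classical
  obtain ⟨m, hm', hm⟩ : ∃ m, ν (m + 1) < ν 0 ∧ ∀ i ≤ m, ν i = ν 0 := by
    refine ⟨Nat.find hex, Nat.find_spec hex, fun i hi => ?_⟩
    cases i with
    | zero => rfl
    | succ i => exact le_antisymm (hN.anti (Nat.zero_le _)) (not_lt.mp (Nat.find_min hex hi))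
  -- Upper bounds for the rows of the rest: its own caps, and one box less in the lowest row m of
  -- maximal length, to force a box of the strip there.
  obtain ⟨u, hu⟩ : ∃ u : ℕ → ℕ, ∀ j, u j =
      min (if j = m then ν j - 1 else ν j) (S (j + 1) - p (j + 1)) := ⟨_, fun _ => rfl⟩
  have hstar := hN.le_prefixSum_add h hpos hm hm' hu
  have hWs := prefixSum_succ u
  have hW0 : prefixSum u 0 = 0 := by simp [prefixSum]
  have hum := hu m
  rw [if_pos rfl] at hum
  have hνu : ∀ i, ν (i + 1) ≤ u i ∧ u i ≤ ν i ∧ u i + p (i + 1) ≤ S (i + 1) := by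
    intro i
    have h1 := hN.anti (show i ≤ i + 1 by omega)
    have h2 := hN.cap (i + 1)
    rw [hu]
    by_cases him : i = m
    · subst him
      have := hm i le_rfl
      simp only [if_true]
      omega
    · simp only [him, if_false]
      omega
  -- Row i of the rest must lie between ν (i + 1) and u i. These are the least tail sums so allowed,
  -- which is the most dominant choice.
  obtain ⟨M, hM⟩ : ∃ M : ℕ → ℕ, ∀ i, M i = max (N (i + 1)) (S 1 - prefixSum u i) :=
    ⟨_, fun _ => rfl⟩
  have hstep : ∀ i, ν (i + 1) + M (i + 1) ≤ M i ∧ M i ≤ u i + M (i + 1) := by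
    intro i
    have h1 := hN.N_eq (i + 1)
    have h2 := hWs i
    have h3 := hνu i
    rw [hM, hM]
    omega
  have hNS := hN.N_le
  have hmν := hm m le_rfl
  refine ⟨fun i => M i - M (i + 1), M, ⟨?_, ?_, ?_, ?_, ?_⟩, ?_, ⟨m, ?_, hm⟩, ?_⟩
  · refine antitone_nat_of_succ_le fun i => ?_
    have := hstep i
    have := hstep (i + 1)
    have := hνu (i + 1)
    omega
  · intro i
    have := hstep i
    omega
  · intro i
    have h1 := hstar i
    have h2 := hNS (i + 1)
    rw [hM]
    omega
  · have := hNS 1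
    rw [hM, hW0]
    simp only [zero_add]
    omega
  · intro i
    have := hstep i
    have := hνu i
    omega
  · intro i
    have := hstep i
    have := hνu i
    simp only
    omega
  · have := hstep m
    simp only
    omega
  · intro hδ
    -- A strip inside row 0 shortens it by α 0 ≥ 2. Either ν has one row, or the cut came from the
    -- cap and ν 0 = S 0 - p 1; both violate the cap at 0, since p 0 = p 1 + 1.
    by_contra hno
    push Not at hno
    have hκ : ∀ b, 1 ≤ b → M b - M (b + 1) = ν b := fun b hb =>
      le_antisymm (by have := hstep b; have := hνu b; omega) (hno b hb)
    have hm0 : m = 0 := by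
      by_contra hne
      have h1 := hκ m (by omega)
      have h2 := hstep m
      omega
    have hM1 : M 1 = N 1 := by
      have key : ∀ d, M 1 - M (1 + d) = N 1 - N (1 + d) ∧ M (1 + d) ≤ M 1 ∧ N (1 + d) ≤ N 1 := by
        intro d
        induction d with
        | zero => simp
        | succ d ih =>
          have h1 := hκ (1 + d) (by omega)
          have h2 := hN.N_eq (1 + d)
          have h3 := hstep (1 + d)
          rw [← add_assoc]
          omega
      have h1 := key (L + 1)
      have h2 := (hN.eq_zero h (show L + 1 ≤ 1 + (L + 1) by omega)).2
      have h3 : M (1 + (L + 1)) = 0 := by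
        have h4 := hstar (1 + (L + 1))
        have h5 := h.S_eq_zero (1 + (L + 1) + 1) (by omega)
        have h6 := hNS (1 + (L + 1) + 1)
        rw [hM]
        omega
      omega
    have h1 := hM 1
    have h2 := hWs 0
    have h3 := hN.N_eq 0
    have h4 := hN.N_eq 1
    have h5 := hN.cap 0
    have h6 := (h.p_eq 0).resolve_right fun h' => h'.1 hδ
    have h7 := (h.le_sub 1).1
    subst hm0
    simp only [zero_add] at *
    have h8 : ν 1 = 0 → N 1 = 0 := by
      intro h9
      by_contra hne
      have := hN.pos_of_N_pos h (Nat.pos_of_ne_zero hne)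
      omega
    have h9 := hνu 0
    have h10 := hstep 0
    simp only [zero_add] at *
    omega

end IsAdmissible

/-! ### Lattice words with prescribed blocks -/

/-- The weakly increasing word with `d i` letters `i` for `i < n`. -/
def increasingWord (d : ℕ → ℕ) : ℕ → List ℕ
  | 0 => []
  | n + 1 => increasingWord d n ++ List.replicate (d n) n

theorem length_increasingWord (d : ℕ → ℕ) (n : ℕ) :
    (increasingWord d n).length = prefixSum d n := by
  induction n with
  | zero => simp [increasingWord, prefixSum]
  | succ n ih => simp [increasingWord, ih, prefixSum_succ]

theorem lt_of_mem_increasingWord {d : ℕ → ℕ} {n x : ℕ} (hx : x ∈ increasingWord d n) : x < n := by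
  induction n with
  | zero => simp [increasingWord] at hx
  | succ n ih =>
    rw [increasingWord, List.mem_append] at hx
    rcases hx with hx | hx
    · exact (ih hx).trans (Nat.lt_succ_self n)
    · rw [List.eq_of_mem_replicate hx]
      exact Nat.lt_succ_self n

theorem pairwise_increasingWord (d : ℕ → ℕ) (n : ℕ) : (increasingWord d n).Pairwise (· ≤ ·) := by
  induction n with
  | zero => simp [increasingWord]
  | succ n ih =>
    rw [increasingWord, List.pairwise_append]
    refine ⟨ih, List.pairwise_replicate.mpr (Or.inr le_rfl), fun a ha b hb => ?_⟩
    rw [List.eq_of_mem_replicate hb]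
    exact (lt_of_mem_increasingWord ha).le

theorem count_increasingWord (d : ℕ → ℕ) (n i : ℕ) :
    (increasingWord d n).count i = if i < n then d i else 0 := by
  induction n with
  | zero => simp [increasingWord]
  | succ n ih =>
    rw [increasingWord, List.count_append, ih, List.count_replicate]
    rcases Nat.lt_trichotomy i n with h | rfl | h
    · simp [h, h.ne', show i < n + 1 by omega]
    · simp
    · simp [show ¬ i < n by omega, h.ne, show ¬ i < n + 1 by omega]

theorem List.Pairwise.getD_le {l : List ℕ} (hl : l.Pairwise (· ≤ ·)) {a b : ℕ} (hab : a ≤ b)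
    (hb : b < l.length) : l.getD a 0 ≤ l.getD b 0 := by
  rw [List.getD_eq_getElem _ _ (by omega), List.getD_eq_getElem _ _ hb]
  rcases hab.eq_or_lt with rfl | h
  · exact le_rfl
  · exact List.pairwise_iff_getElem.mp hl a b _ _ h

theorem List.Pairwise.le_getD_of_mem {l : List ℕ} (hl : l.Pairwise (· ≤ ·)) {x : ℕ} (hx : x ∈ l) :
    l.getD 0 0 ≤ x ∧ x ≤ l.getD (l.length - 1) 0 := by
  obtain ⟨t, ht, rfl⟩ := List.mem_iff_getElem.mp hx
  rw [← List.getD_eq_getElem _ 0 ht]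
  exact ⟨hl.getD_le (Nat.zero_le t) ht, hl.getD_le (by omega) (by omega)⟩

theorem List.pairwise_le_of_getD {l : List ℕ}
    (h : ∀ t, t + 1 < l.length → l.getD t 0 ≤ l.getD (t + 1) 0) : l.Pairwise (· ≤ ·) := by
  refine (List.isChain_iff_getElem.mpr fun t ht => ?_).pairwise
  have := h t ht
  rwa [List.getD_eq_getElem _ _ (by omega), List.getD_eq_getElem _ _ ht] at this

/-- Every intermediate word has at least as many letters i as q and at most as many letters i + 1 as
s ++ q, so the order inside s is irrelevant. -/
theorem IsLattice.append {s q : List ℕ} (hq : IsLattice q)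
    (h : ∀ i, (s ++ q).count (i + 1) ≤ q.count i) : IsLattice (s ++ q) := by
  induction s with
  | nil => exact hq
  | cons r s ih =>
    refine ⟨ih fun i => ?_, fun i => ?_⟩
    · refine le_trans ?_ (h i)
      rw [List.cons_append, List.count_cons]
      omega
    · refine (h i).trans ?_
      change q.count i ≤ (r :: (s ++ q)).count i
      rw [List.count_cons, List.count_append]
      omega

/-- A weakly increasing block adds a horizontal strip. -/
theorem IsLattice.count_succ_le_of_pairwise {s q : List ℕ} (h : IsLattice (s ++ q))
    (hs : s.Pairwise (· ≤ ·)) (i : ℕ) : (s ++ q).count (i + 1) ≤ q.count i := by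
  induction s with
  | nil => exact h.count_succ_le i
  | cons r s ih =>
    rw [List.pairwise_cons] at hs
    -- A sorted block headed by i + 1 contains no letter i, so the lattice condition already
    -- compares with q.
    by_cases hr : r = i + 1
    · have h1 := h.count_succ_le i
      have h2 : (r :: s).count i = 0 := by
        rw [List.count_eq_zero]
        intro hi
        rcases List.mem_cons.mp hi with h | h
        · omega
        · have := hs.1 i h
          omega
      refine h1.trans ?_
      rw [List.count_append, h2, zero_add]
    · have := ih h.1 hs.2
      rw [List.cons_append, List.count_cons]
      simpa [hr] using this

/-- The entry in position `t` is larger than the next one. -/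
def HasFall (q : List ℕ) (t : ℕ) : Prop := q.getD (t + 1) 0 < q.getD t 0

theorem fitsBlocks_append_iff {α : ℕ → ℕ} {δ : ℕ → Prop} {s q : List ℕ} (hs : s.length = α 0)
    (h0 : 0 < α 0) (hδ : ∀ i, δ (i + 1) → 0 < α (i + 1)) :
    FitsBlocks α δ (HasFall (s ++ q)) ↔ s.Pairwise (· ≤ ·) ∧
      (δ 0 → q.getD 0 0 < s.getD (α 0 - 1) 0) ∧
      FitsBlocks (fun i => α (i + 1)) (fun i => δ (i + 1)) (HasFall q) := by
  have hl : ∀ t, t < α 0 → (s ++ q).getD t 0 = s.getD t 0 := fun t ht =>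
    List.getD_append _ _ _ _ (hs ▸ ht)
  have hr : ∀ t, (s ++ q).getD (α 0 + t) 0 = q.getD t 0 := fun t => by
    rw [List.getD_append_right _ _ _ _ (by omega), hs, Nat.add_sub_cancel_left]
  have hfall : ∀ t, HasFall (s ++ q) (α 0 + t) ↔ HasFall q t := fun t => by
    rw [HasFall, HasFall, hr, add_assoc, hr]
  have hmid : HasFall (s ++ q) (α 0 - 1) ↔ q.getD 0 0 < s.getD (α 0 - 1) 0 := by
    rw [HasFall, hl (α 0 - 1) (by omega), show α 0 - 1 + 1 = α 0 + 0 by omega, hr]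
  have hpre := prefixSum_succ_left α
  have hzero : ∀ α : ℕ → ℕ, prefixSum α 0 = 0 := fun α => by simp [prefixSum]
  have hone : prefixSum α 1 = α 0 := by simp [prefixSum]
  constructor
  · rintro ⟨hA, hD⟩
    refine ⟨List.pairwise_le_of_getD fun t ht => ?_, fun h => ?_, fun i t h1 h2 => ?_,
      fun i hi => ?_⟩
    · have := hA 0 t (by rw [hzero]; omega) (by rw [zero_add, hone]; omega)
      rwa [HasFall, hl _ (by omega), hl _ (by omega), not_lt] at this
    · have := hD 0 h
      rwa [zero_add, hone, hmid] at this
    · rw [← hfall]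
      exact hA (i + 1) _ (by rw [hpre]; omega) (by rw [hpre]; omega)
    · have h1 := hD (i + 1) hi
      have h2 := hδ i hi
      rw [hpre, prefixSum_succ, Nat.add_sub_assoc (by omega), hfall] at h1
      rwa [prefixSum_succ]
  · rintro ⟨hP, hM, hA, hD⟩
    refine ⟨fun i t h1 h2 => ?_, fun i hi => ?_⟩
    · cases i with
      | zero =>
        rw [zero_add, hone] at h2
        rw [HasFall, hl _ (by omega), hl _ (by omega), not_lt]
        exact hP.getD_le (by omega) (by omega)
      | succ i =>
        rw [hpre] at h1 h2
        obtain ⟨t, rfl⟩ := Nat.exists_eq_add_of_le (show α 0 ≤ t by omega)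
        rw [hfall]
        exact hA i t (by omega) (by omega)
    · cases i with
      | zero =>
        rw [zero_add, hone, hmid]
        exact hM hi
      | succ i =>
        have h1 := hD i hi
        have h2 := hδ i hi
        rw [prefixSum_succ] at h1
        rwa [hpre, prefixSum_succ, Nat.add_sub_assoc (by omega), hfall]

theorem IsRowData.pos_of_mark {α S p : ℕ → ℕ} {δ : ℕ → Prop} {L : ℕ}
    (h : IsRowData α S p δ L) {i : ℕ} (hi : δ i) : 0 < α i := by
  have h1 := (h.p_eq i).resolve_right fun h' => h'.1 hi
  have h2 := h.p_le i
  have := h.two_le i (by omega)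
  omega

/-- Every admissible partition is the content of a lattice word with the prescribed blocks. -/
theorem IsAdmissible.exists_latticeWord : ∀ {L : ℕ} {α S p ν N : ℕ → ℕ} {δ : ℕ → Prop},
    IsRowData α S p δ L → IsAdmissible S p ν N →
    ∃ q : List ℕ, IsLattice q ∧ (∀ i, q.count i = ν i) ∧ q.length = S 0 ∧
      FitsBlocks α δ (HasFall q) ∧ ∀ i ≤ q.getD 0 0, ν i = ν 0
  | 0, α, S, p, ν, N, δ, h, hN => by
    have hS := h.S_eq_zero
    refine ⟨[], trivial, fun i => ?_, by simp [hS], ⟨fun i t _ ht => ?_, fun i hi => ?_⟩, ?_⟩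
    · simp [(hN.eq_zero h (Nat.zero_le i)).1]
    · simp [HasFall]
    · have := h.p_eq i
      have := h.p_eq_zero i (by omega)
      have := (h.p_eq i).resolve_right fun h' => h'.1 hi
      omega
    · intro i hi
      rw [List.getD_nil] at hi
      rw [Nat.le_zero.mp hi]
  | L + 1, α, S, p, ν, N, δ, h, hN => by
    obtain ⟨κ, M, hM, hstrip, ⟨m, hmκ, hm⟩, hb⟩ := hN.exists_strip h
    obtain ⟨q, hq, hqc, hql, hqf, hqh⟩ := hM.exists_latticeWord h.succ
    have hν : ∀ i, L + 1 ≤ i → ν i = 0 := fun i hi => (hN.eq_zero h hi).1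
    set s := increasingWord (fun i => ν i - κ i) (L + 1) with hs
    have hsc : ∀ i, s.count i = ν i - κ i := fun i => by
      rw [hs, count_increasingWord]
      split_ifs with hi
      · rfl
      · rw [hν i (by omega)]; omega
    have hsP : s.Pairwise (· ≤ ·) := pairwise_increasingWord _ _
    have hcount : ∀ i, (s ++ q).count i = ν i := fun i => by
      rw [List.count_append, hsc, hqc]
      have := hstrip i
      omega
    have hsl : s.length = α 0 := by
      have h1 : prefixSum (fun i => ν i - κ i) (L + 1) + prefixSum κ (L + 1) =
          prefixSum ν (L + 1) := by
        unfold prefixSum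
        rw [← Finset.sum_add_distrib]
        exact Finset.sum_congr rfl fun i _ => Nat.sub_add_cancel (hstrip i).2
      have h2 := hN.prefixSum_add (L + 1)
      have h3 := hM.prefixSum_add (L + 1)
      have h4 := (hN.eq_zero h le_rfl).2
      have h5 := (hM.eq_zero h.succ (show L ≤ L + 1 by omega)).2
      have h6 := h.S_eq 0
      simp only [zero_add] at h3 h6
      rw [hs, length_increasingWord]
      omega
    have hα0 := h.two_le 0 (by omega)
    have hmem : ∀ i, κ i < ν i → i ∈ s := fun i hi => by
      rw [← List.count_pos_iff, hsc]
      omega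
    refine ⟨s ++ q, hq.append fun i => ?_, hcount, ?_, ?_, fun i hi => ?_⟩
    · rw [hcount, hqc]
      exact (hstrip i).1
    · have h6 := h.S_eq 0
      rw [List.length_append, hsl, hql, h6]
    · refine (fitsBlocks_append_iff hsl (by omega) fun i hi => h.pos_of_mark hi).mpr
        ⟨hsP, fun hδ => ?_, hqf⟩
      obtain ⟨b, hb1, hbκ⟩ := hb hδ
      have h1 := (hsP.le_getD_of_mem (hmem b hbκ)).2
      rw [hsl] at h1
      refine lt_of_lt_of_le ?_ h1
      -- Otherwise rows 0 and b of κ are equal, so κ b = κ 0 ≥ ν 1 ≥ ν b, although the strip has a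
      -- box in row b.
      by_contra hge
      have h2 := hqh b (not_lt.mp hge)
      have h3 := (hstrip 0).1
      have h4 := hN.anti hb1
      simp only [zero_add] at h3
      omega
    -- The head of s is its smallest letter, hence at most m.
    · refine hm i (hi.trans ?_)
      rw [List.getD_append _ _ _ _ (by omega)]
      exact (hsP.le_getD_of_mem (hmem m hmκ)).1

theorem List.countP_le_eq (q : List ℕ) (i : ℕ) :
    q.countP (i ≤ ·) = q.count i + q.countP (i + 1 ≤ ·) := by
  induction q with
  | nil => simp
  | cons x q ih =>
    rw [List.countP_cons, List.countP_cons, List.count_cons, ih]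
    rcases Nat.lt_trichotomy x i with h | rfl | h
    · simp [h.ne, show ¬ i ≤ x by omega, show ¬ i + 1 ≤ x by omega]
    · simp
      omega
    · simp [h.ne', h.le, show i + 1 ≤ x by omega]
      omega

/-- The content of a lattice word with the prescribed blocks is admissible. -/
theorem IsRowData.bounds_of_latticeWord : ∀ {L : ℕ} {α S p : ℕ → ℕ} {δ : ℕ → Prop},
    IsRowData α S p δ L → ∀ {q : List ℕ}, IsLattice q → q.length = S 0 →
    FitsBlocks α δ (HasFall q) →
    (∀ i, q.countP (i ≤ ·) ≤ S i) ∧ (∀ i, q.count i + p i ≤ S i) ∧ p 0 ≤ q.countP (1 ≤ ·)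
  | 0, α, S, p, δ, h, q, hq, hl, hf => by
    have hS := h.S_eq_zero
    rw [hS 0 le_rfl, List.length_eq_zero_iff] at hl
    subst hl
    have hp := fun i => h.p_eq_zero i (by omega)
    simp [hp]
  | L + 1, α, S, p, δ, h, q', hq', hl, hf => by
    have hα0 := h.two_le 0 (by omega)
    have hS0 := h.S_eq 0
    simp only [zero_add] at hS0
    obtain ⟨s, q, rfl, hs⟩ : ∃ s q, q' = s ++ q ∧ s.length = α 0 :=
      ⟨q'.take (α 0), q'.drop (α 0), (List.take_append_drop _ _).symm, by
        rw [List.length_take]; omega⟩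
    obtain ⟨hsP, hδ, hqf⟩ :=
      (fitsBlocks_append_iff hs (by omega) fun i hi => h.pos_of_mark hi).mp hf
    rw [List.length_append, hs] at hl
    have hq := hq'.of_append
    obtain ⟨hA, hB, hC⟩ := h.succ.bounds_of_latticeWord hq (by simp only [zero_add]; omega) hqf
    have hcount := hq'.count_succ_le_of_pairwise hsP
    have htail : ∀ i, (s ++ q).countP (i + 1 ≤ ·) ≤ q.countP (i ≤ ·) := by
      intro i
      have key : ∀ d, (s ++ q).countP (i + 1 ≤ ·) + q.countP (i + d ≤ ·) ≤
          q.countP (i ≤ ·) + (s ++ q).countP (i + d + 1 ≤ ·) := by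
        intro d
        induction d with
        | zero => rw [add_zero, add_comm]
        | succ d ih =>
          have h1 := q.countP_le_eq (i + d)
          have h2 := (s ++ q).countP_le_eq (i + d + 1)
          have h3 := hcount (i + d)
          rw [← add_assoc]
          omega
      have h1 := key (s ++ q).length
      have h2 : (s ++ q).countP (i + (s ++ q).length + 1 ≤ ·) = 0 := by
        rw [List.countP_eq_zero]
        intro x hx
        have := hq'.lt_length x hx
        rw [decide_eq_true_eq]
        omega
      omega
    have hzero : ∀ l : List ℕ, l.countP (0 ≤ ·) = l.length := fun l => by simp
    -- The fall required at an overlap makes the last letter of the block positive, so each overlap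
    -- accounts for its own positive letter. This gives the cap at 0.
    have hp0 : p 0 ≤ (s ++ q).countP (1 ≤ ·) := by
      rw [List.countP_append]
      simp only [zero_add] at hC
      rcases h.p_eq 0 with ⟨h1, h2⟩ | ⟨h1, h2⟩
      · have h3 := hδ h1
        have h4 : 0 < s.countP (1 ≤ ·) := by
          rw [List.countP_pos_iff]
          refine ⟨s.getD (α 0 - 1) 0, ?_, decide_eq_true (by omega)⟩
          rw [List.getD_eq_getElem _ _ (by omega)]
          exact List.getElem_mem _
        simp only [zero_add] at h2
        omega
      · simp only [zero_add] at h2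
        omega
    refine ⟨fun i => ?_, fun i => ?_, hp0⟩
    · cases i with
      | zero => rw [hzero, List.length_append, hs]; omega
      | succ i => exact (htail i).trans (hA i)
    · cases i with
      | zero =>
        have h1 := (s ++ q).countP_le_eq 0
        rw [hzero, List.length_append, hs] at h1
        simp only [zero_add] at h1
        omega
      | succ i =>
        -- Row i + 1 is at most row i of the rest, because the block is a horizontal strip.
        have := hB i
        have := hcount i
        omega

/-! ### The dominance interval -/

theorem lt_partLength_iff {f : ℕ → ℕ} (hf : Antitone f) {N : ℕ} (hN : f N = 0) (i : ℕ) :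
    i < partLength f ↔ f i ≠ 0 := by
  classical
  have hex : ∃ n, f n = 0 := ⟨N, hN⟩
  have hiff : ∀ i, i < Nat.find hex ↔ f i ≠ 0 := fun i => by
    refine ⟨fun h => Nat.find_min hex h, fun h => ?_⟩
    by_contra hi
    have h1 := hf (not_lt.mp hi)
    have h2 := Nat.find_spec hex
    omega
  have hset : {i | f i ≠ 0} = (Finset.range (Nat.find hex) : Set ℕ) := by
    ext i
    rw [Finset.coe_range, Set.mem_Iio, hiff]
    rfl
  rw [partLength, hset, Set.ncard_coe_finset, Finset.card_range, hiff]

theorem prefixSum_eq_partSize {f : ℕ → ℕ} (hf : Antitone f) {M : ℕ} (hM : f M = 0) :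
    prefixSum f M = partSize f := by
  have hle : partLength f ≤ M := by
    by_contra h
    exact (lt_partLength_iff hf hM M).mp (not_le.mp h) hM
  rw [partSize, prefixSum, ← Finset.sum_range_add_sum_Ico f hle]
  refine Nat.add_eq_left.mpr (Finset.sum_eq_zero fun i hi => ?_)
  by_contra h
  have := (lt_partLength_iff hf hM i).mpr h
  rw [Finset.mem_Ico] at hi
  omega

theorem prefixSum_le_partSize {f : ℕ → ℕ} (hf : Antitone f) {M : ℕ} (hM : f M = 0) (k : ℕ) :
    prefixSum f k ≤ partSize f := by
  have h0 : f (max k M) = 0 := Nat.le_zero.mp (hM ▸ hf (le_max_right k M))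
  rw [← prefixSum_eq_partSize hf h0]
  exact prefixSum_mono f (le_max_left k M)

theorem antitone_twoRows {a b : ℕ} (h : b ≤ a) : Antitone (twoRows a b) :=
  antitone_nat_of_succ_le fun i => match i with
    | 0 => h
    | 1 => Nat.zero_le _
    | _ + 2 => le_rfl

theorem partSize_twoRows {a b : ℕ} (h : b ≤ a) : partSize (twoRows a b) = a + b := by
  rw [← prefixSum_eq_partSize (antitone_twoRows h) (M := 2) rfl]
  simp [prefixSum, Finset.sum_range_succ, twoRows]

/-- `ν`, with tail sums `N`, dominates the partition with tail sums `S`. -/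
structure IsDominating (S ν N : ℕ → ℕ) : Prop where
  N_eq : ∀ i, N i = ν i + N (i + 1)
  N_le : ∀ i, N i ≤ S i
  N_zero : N 0 = S 0

theorem IsDominating.prefixSum_add {S ν N : ℕ → ℕ} (h : IsDominating S ν N) (i : ℕ) :
    prefixSum ν i + N i = S 0 := by
  induction i with
  | zero => simp [prefixSum, h.N_zero]
  | succ i ih => rw [prefixSum_succ]; have := h.N_eq i; omega

namespace IsRowData

variable {α S p : ℕ → ℕ} {δ : ℕ → Prop} {L : ℕ}

theorem eq_zero (h : IsRowData α S p δ L) {i : ℕ} (hi : L ≤ i) : α i = 0 := by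
  have := h.S_eq i
  have := h.S_eq_zero i hi
  omega

theorem partSize_eq (h : IsRowData α S p δ L) : partSize α = S 0 := by
  rw [← prefixSum_eq_partSize h.anti (h.eq_zero le_rfl), ← h.prefixSum_add L,
    h.S_eq_zero L le_rfl, add_zero]

/-- From the second partial sum on, a two-row partition has reached its full size, so being
dominated by it only bounds the first row. -/
theorem mem_dominanceInterval_iff (h : IsRowData α S p δ L) (ν : YoungDiagram) :
    ν ∈ dominanceInterval α (twoRows (partSize α - p 0) (p 0)) ↔
      ∃ N, IsDominating S ν.rowLen N ∧ ν.rowLen 0 + p 0 ≤ S 0 := by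
  have hν : Antitone ν.rowLen := fun _ _ hij => ν.rowLen_anti _ _ hij
  have hν0 : ν.rowLen (ν.colLen 0) = 0 := ν.rowLen_eq_zero le_rfl
  have h2 : 2 * p 0 ≤ S 0 := by
    have := h.p_le 0
    have := h.two_mul_le 0
    omega
  have htwo := partSize_twoRows (show p 0 ≤ S 0 - p 0 by omega)
  rw [h.partSize_eq]
  constructor
  · rintro ⟨⟨hs, hd⟩, -, hd'⟩
    rw [h.partSize_eq] at hs
    have hle := prefixSum_le_partSize hν hν0
    refine ⟨fun i => S 0 - prefixSum ν.rowLen i, ⟨fun i => ?_, fun i => ?_, ?_⟩, ?_⟩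
    · have h1 := hle (i + 1)
      rw [prefixSum_succ] at h1 ⊢
      omega
    · have h1 := h.prefixSum_add i
      have h2 : prefixSum α i ≤ prefixSum ν.rowLen i := hd i
      omega
    · simp [prefixSum]
    · have h1 := hd' 1
      simp only [Finset.sum_range_one, twoRows] at h1
      omega
  · rintro ⟨N, hN, hcap⟩
    have hadd := hN.prefixSum_add
    have hs : partSize ν.rowLen = S 0 := by
      have h0 : ν.rowLen (max L (ν.colLen 0)) = 0 := ν.rowLen_eq_zero (le_max_right _ _)
      have h1 := hadd (max L (ν.colLen 0))
      have h2 := hN.N_le (max L (ν.colLen 0))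
      have h3 := h.S_eq_zero _ (le_max_left L (ν.colLen 0))
      rw [← prefixSum_eq_partSize hν h0]
      omega
    refine ⟨⟨by rw [h.partSize_eq, hs], fun k => ?_⟩, by rw [hs, htwo]; omega, fun k => ?_⟩
    · change prefixSum α k ≤ prefixSum ν.rowLen k
      have := h.prefixSum_add k
      have := hadd k
      have := hN.N_le k
      omega
    · change prefixSum ν.rowLen k ≤ prefixSum _ k
      match k with
      | 0 => simp [prefixSum]
      | 1 => simp only [prefixSum, Finset.sum_range_one, twoRows]; omega
      | k + 2 =>
        have h1 := prefixSum_mono (twoRows (S 0 - p 0) (p 0)) (show 2 ≤ k + 2 by omega)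
        have h3 : prefixSum (twoRows (S 0 - p 0) (p 0)) 2 = S 0 - p 0 + p 0 := by
          simp [prefixSum, Finset.sum_range_succ, twoRows]
        have := hadd (k + 2)
        omega

/-! ### Witness vectors and the bounds below the first row -/

/-- If all the rows above row `i` are at least `c`, dominance forces additional boxes. -/
theorem prefixSum_add_deficit_le (h : IsRowData α S p δ L) {ν N : ℕ → ℕ}
    (hN : IsDominating S ν N) {c i : ℕ} (hc : ∀ j < i, c ≤ ν j) :
    prefixSum α i + prefixSum (fun j => c - α j) i ≤ prefixSum ν i := by
  induction i with
  | zero => simp [prefixSum]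
  | succ i ih =>
    have h1 := ih fun j hj => hc j (by omega)
    have h2 := hc i (by omega)
    -- If α i ≥ c, all earlier parts are at least c as well; the deficits vanish and plain dominance
    -- suffices.
    rcases Nat.lt_or_ge (α i) c with h3 | h3
    · rw [prefixSum_succ, prefixSum_succ, prefixSum_succ]
      omega
    · have h4 : prefixSum (fun j => c - α j) (i + 1) = 0 :=
        Finset.sum_eq_zero fun j hj => by
          rw [Finset.mem_range] at hj
          have := h.anti (show j ≤ i by omega)
          omega
      have h5 := hN.prefixSum_add (i + 1)
      have h6 := hN.N_le (i + 1)
      have h7 := h.prefixSum_add (i + 1)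
      omega

theorem cap_of_le (h : IsRowData α S p δ L) {ν N : ℕ → ℕ} (hν : Antitone ν)
    (hN : IsDominating S ν N) {i : ℕ}
    (hi : p i ≤ prefixSum (fun j => S i + 1 - p i - α j) i) : ν i + p i ≤ S i := by
  by_contra hlt
  have h1 := h.prefixSum_add_deficit_le hN (c := S i + 1 - p i) (i := i) fun j hj => by
    have := hν hj.le
    omega
  have h2 := hN.prefixSum_add i
  have h3 := h.prefixSum_add i
  have h4 := hN.N_eq i
  omega

/-- Raising the rows above i to c costs only e < p i boxes. With row i equal to c, just above its
cap, p i - e - 1 boxes are left for row i + 1, fewer than c because 2 * p i ≤ S i. -/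
theorem exists_dominating_of_lt (h : IsRowData α S p δ L) {i : ℕ} (hi : 1 ≤ i)
    (hp : prefixSum (fun j => S i + 1 - p i - α j) i < p i) :
    ∃ (ν : YoungDiagram) (N : ℕ → ℕ), IsDominating S ν.rowLen N ∧ ν.rowLen 0 + p 0 ≤ S 0 ∧
      S i < ν.rowLen i + p i := by
  have hpi := h.p_le i
  have hSi := h.two_mul_le i
  obtain ⟨c, hc⟩ : ∃ c, S i + 1 - p i = c := ⟨_, rfl⟩
  rw [hc] at hp
  set e := prefixSum (fun j => c - α j) i with he
  have hf : ∃ f : ℕ → ℕ, (∀ j < i, f j = max (α j) c) ∧ f i = c ∧ f (i + 1) = p i - e - 1 ∧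
      ∀ j, i + 1 < j → f j = 0 := by
    refine ⟨fun j => if j < i then max (α j) c else if j = i then c else
      if j = i + 1 then p i - e - 1 else 0, fun j hj => by simp [hj], by simp, by simp,
      fun j hj => ?_⟩
    simp [show ¬ j < i by omega, show j ≠ i by omega, show j ≠ i + 1 by omega]
  obtain ⟨f, f1, f2, f3, f4⟩ := hf
  have hanti : Antitone f := by
    refine antitone_nat_of_succ_le fun j => ?_
    rcases Nat.lt_trichotomy (j + 1) i with hj | hj | hj
    · rw [f1 j (by omega), f1 (j + 1) hj]
      have := h.anti (show j ≤ j + 1 by omega)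
      omega
    · rw [f1 j (by omega), hj, f2]
      omega
    · rcases Nat.eq_or_lt_of_le (show i ≤ j by omega) with rfl | hj'
      · rw [f2, f3]
        omega
      · rw [f4 (j + 1) (by omega)]
        omega
  obtain ⟨ν, hν⟩ := exists_youngDiagram hanti (f4 (i + 2) (by omega))
  have hpre : ∀ k ≤ i, prefixSum f k = prefixSum α k + prefixSum (fun j => c - α j) k := by
    intro k hk
    unfold prefixSum
    rw [← Finset.sum_add_distrib]
    refine Finset.sum_congr rfl fun j hj => ?_
    rw [Finset.mem_range] at hj
    rw [f1 j (by omega)]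
    omega
  have hpi1 : prefixSum f (i + 1) = prefixSum α i + e + c := by
    rw [prefixSum_succ, hpre i le_rfl, f2]
  have hadd := h.prefixSum_add
  have hpi2 : ∀ k, i + 2 ≤ k → prefixSum f k = S 0 := by
    intro k hk
    induction k, hk using Nat.le_induction with
    | base =>
      rw [prefixSum_succ, hpi1, f3]
      have := hadd i
      omega
    | succ k hk ih => rw [prefixSum_succ, ih, f4 k (by omega), add_zero]
  have hle : ∀ k, prefixSum f k ≤ S 0 := fun k => by
    rw [← hpi2 (max (i + 2) k) (le_max_left _ _)]
    exact prefixSum_mono f (le_max_right _ _)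
  refine ⟨ν, fun k => S 0 - prefixSum f k, ⟨fun k => ?_, fun k => ?_, ?_⟩, ?_, ?_⟩
  · have := hle (k + 1)
    rw [hν]
    rw [prefixSum_succ] at this ⊢
    omega
  · have h1 := hadd k
    rcases Nat.lt_trichotomy k (i + 1) with hk | rfl | hk
    · have := hpre k (by omega)
      omega
    · have h2 := hadd i
      have h3 := h.two_mul_le (i + 1)
      omega
    · rw [hpi2 k (by omega)]
      omega
  · simp [prefixSum]
  -- The caps S j - p j decrease strictly, so c, one more than the cap at i ≥ 1, still respects the
  -- cap at 0.
  · have hC : ∀ j, j < L → S (j + 1) - p (j + 1) + 1 ≤ S j - p j := by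
      intro j hj
      have := h.S_eq j
      have := h.p_eq j
      have := h.two_le j hj
      have := h.le_sub (j + 1)
      omega
    have hC0 : ∀ k, k < L → S (k + 1) - p (k + 1) + 1 ≤ S 0 - p 0 := by
      intro k hk
      induction k with
      | zero => exact hC 0 hk
      | succ k ih =>
        have := ih (by omega)
        have := hC (k + 1) hk
        omega
    have h1 := hC0 (i - 1) (by omega)
    rw [Nat.sub_add_cancel hi] at h1
    have h2 := h.S_eq 0
    have h3 := h.p_le 0
    have h4 := h.two_mul_le 1
    simp only [zero_add] at h2
    have h5 := h.le_sub i
    have h6 := h.le_sub 0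
    rw [hν, f1 0 (by omega)]
    omega
  · rw [hν, f2]
    omega

end IsRowData

/-! ### The support of the ribbon and the proof of the theorem -/

namespace SkewShape.IsPartitionRibbon

variable {R : SkewShape} {α : ℕ → ℕ}

theorem isRowData (h : R.IsPartitionRibbon α (partLength α))
    (hpos : ∀ i, i < partLength α ↔ α i ≠ 0) :
    IsRowData α (fun i => ∑ q ∈ Finset.Ico i (partLength α), α q) R.overlap R.Overlaps
      (partLength α) := by
  classical
  have hov : ∀ i, R.Overlaps i → i + 1 < partLength α := fun i hi =>
    (hpos (i + 1)).mpr (by have := h.overlaps_ne_zero hi; omega)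
  refine ⟨fun i => ?_, fun i => ?_, h.anti, fun i hi => h.two_le i ((hpos i).mp hi),
    fun i hi => by simp [hi], fun i hi => ?_⟩
  · rcases Nat.lt_or_ge i (partLength α) with hi | hi
    · exact Finset.sum_eq_sum_Ico_succ_bot hi α
    · have := h.eq_zero i hi
      simp [hi, show partLength α ≤ i + 1 by omega, this]
  · rw [h.overlap_eq, h.overlap_eq]
    by_cases ho : R.Overlaps i
    · refine Or.inl ⟨ho, ?_⟩
      rw [← Finset.insert_Ico_succ_left_eq_Ico (show i < partLength α by have := hov i ho; omega),
        Finset.filter_insert, if_pos ho, Finset.card_insert_of_notMem (by simp)]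
      rfl
    · refine Or.inr ⟨ho, ?_⟩
      congr 1
      ext j
      simp only [Finset.mem_filter, Finset.mem_Ico]
      constructor
      · rintro ⟨⟨h1, h2⟩, h3⟩
        have : i ≠ j := fun he => ho (he ▸ h3)
        exact ⟨⟨by omega, h2⟩, h3⟩
      · rintro ⟨⟨h1, h2⟩, h3⟩
        exact ⟨⟨by omega, h2⟩, h3⟩
  · rw [h.overlap_eq, Finset.card_eq_zero, Finset.filter_eq_empty_iff]
    intro j hj hoj
    rw [Finset.mem_Ico] at hj
    have := hov j hoj
    omega

theorem mem_schurSupport_iff_isAdmissible {S p : ℕ → ℕ} {L : ℕ} (h : R.IsPartitionRibbon α L)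
    (hd : IsRowData α S p R.Overlaps L) (ν : YoungDiagram) :
    ν ∈ R.schurSupport ↔ ∃ N, IsAdmissible S p ν.rowLen N := by
  have hL : prefixSum α L = S 0 := by
    rw [← hd.prefixSum_add L, hd.S_eq_zero L le_rfl, add_zero]
  rw [h.mem_schurSupport_iff]
  constructor
  · rintro ⟨q, ⟨hl, hq, hf⟩, hc⟩
    obtain ⟨h1, h2, -⟩ := hd.bounds_of_latticeWord hq (hl.trans hL) hf
    refine ⟨fun i => q.countP (i ≤ ·), fun _ _ hij => ν.rowLen_anti _ _ hij, fun i => ?_, h1, ?_,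
      fun i => ?_⟩
    · rw [← hc]
      exact q.countP_le_eq i
    · simp [hl, hL]
    · rw [← hc]
      exact h2 i
  · rintro ⟨N, hN⟩
    obtain ⟨q, hq, hc, hl, hf, -⟩ := hN.exists_latticeWord hd
    exact ⟨q, ⟨hl.trans hL.symm, hq, hf⟩, hc⟩

end SkewShape.IsPartitionRibbon

/-- Truncated subtraction of α j is the positive part; the hypothesis keeps the subtraction of p i
from truncating. -/
theorem witnessSize_eq {α p : ℕ → ℕ} {i : ℕ}
    (hp : p i ≤ ∑ q ∈ Finset.Ico i (partLength α), α q) :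
    witnessSize α p i = (prefixSum
      (fun j => ∑ q ∈ Finset.Ico i (partLength α), α q + 1 - p i - α j) i : ℕ) := by
  rw [witnessSize, prefixSum, Nat.cast_sum]
  refine Finset.sum_congr rfl fun j _ => ?_
  rw [rest, ← Nat.cast_sum]
  have := hp
  omega

theorem theorem1p4 (α p : ℕ → ℕ) (hα : Antitone α) (hα2 : ∀ i, α i ≠ 0 → 2 ≤ α i)
    (R : SkewShape) (hR : R.IsRibbon) (hrow : ∀ i, R.rowLen i = α i)
    (hp : ∀ i, R.overlap i = p i) :
    R.schurSupport = dominanceInterval α (twoRows (partSize α - p 0) (p 0)) ↔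
      (partLength p < 2 ∨
        (2 ≤ partLength p ∧
          ∀ i, 1 ≤ i → i ≤ partLength p - 1 → (p i : ℤ) ≤ witnessSize α p i)) := by
  obtain ⟨L, hL⟩ := hR.isPartitionRibbon hα hα2 hrow
  have hpos := lt_partLength_iff hα (hL.eq_zero L le_rfl)
  have h : R.IsPartitionRibbon α (partLength α) :=
    { hL with
      eq_zero := fun i hi => by
        by_contra hne
        exact absurd ((hpos i).mpr hne) (not_lt.mpr hi) }
  obtain rfl : R.overlap = p := funext hp
  have hd := h.isRowData hpos
  set S := fun i => ∑ q ∈ Finset.Ico i (partLength α), α q with hS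
  have hpanti : Antitone R.overlap := antitone_nat_of_succ_le fun i => by
    have := hd.p_eq i
    omega
  have hplen := lt_partLength_iff hpanti (hd.p_eq_zero (partLength α) (by omega))
  have hwit : ∀ i, witnessSize α R.overlap i =
      (prefixSum (fun j => S i + 1 - R.overlap i - α j) i : ℕ) :=
    fun i => witnessSize_eq (hd.le_sub i).1
  -- The indices i ≥ 1 with nonzero overlap are exactly 1, …, ℓ(p) - 1, and there are none if ℓ(p) <
  -- 2.
  have hrhs : (partLength R.overlap < 2 ∨ (2 ≤ partLength R.overlap ∧
      ∀ i, 1 ≤ i → i ≤ partLength R.overlap - 1 →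
        (R.overlap i : ℤ) ≤ witnessSize α R.overlap i)) ↔
      ∀ i, 1 ≤ i → R.overlap i ≠ 0 →
        R.overlap i ≤ prefixSum (fun j => S i + 1 - R.overlap i - α j) i := by
    simp only [← hplen, hwit, Nat.cast_le]
    constructor
    · rintro (h1 | ⟨-, h1⟩) i hi hi'
      · omega
      · exact h1 i hi (by omega)
    · intro h1
      rcases Nat.lt_or_ge (partLength R.overlap) 2 with h2 | h2
      · exact Or.inl h2
      · exact Or.inr ⟨h2, fun i hi hi' => h1 i hi (by omega)⟩
  rw [hrhs, Set.ext_iff]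
  simp only [h.mem_schurSupport_iff_isAdmissible hd, hd.mem_dominanceInterval_iff]
  constructor
  · intro heq i hi _
    by_contra hlt
    obtain ⟨ν, N, hN, h0, hc⟩ := hd.exists_dominating_of_lt hi (not_le.mp hlt)
    obtain ⟨M, hM⟩ := (heq ν).mpr ⟨N, hN, h0⟩
    exact absurd (hM.cap i) (not_le.mpr hc)
  · intro hw ν
    have hν : Antitone ν.rowLen := fun _ _ hij => ν.rowLen_anti _ _ hij
    constructor
    · rintro ⟨N, hN⟩
      exact ⟨N, ⟨hN.N_eq, hN.N_le, hN.N_zero⟩, hN.cap 0⟩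
    · rintro ⟨N, hN, h0⟩
      refine ⟨N, hν, hN.N_eq, hN.N_le, hN.N_zero, fun i => ?_⟩
      rcases Nat.eq_zero_or_pos i with rfl | hi
      · exact h0
      -- Without overlaps the cap follows from dominance: ν i ≤ N i ≤ S i.
      by_cases hpi : R.overlap i = 0
      · have := hN.N_eq i
        have := hN.N_le i
        omega
      · exact hd.cap_of_le hν hN (hw i hi hpi)
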